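/- Let $n\ge 1$ and $0<\alpha<2$. For smooth compactly supported $\phi:\mathbb R^n\to\mathbb R$ put $$(-\Delta)^{\alpha/2}\phi(x)=C_{n,\alpha}\lim_{\epsilon\to0^+}\int_{|x-z|\ge\epsilon}\frac{\phi(x)-\phi(z)}{|x-z|^{n+\alpha}}\,dz,\qquad C_{n,\alpha}=\frac{2^{\alpha}\,\Gamma\left(\frac{n+\alpha}{2}\right)}{\pi^{n/2}\,|\Gamma(-\alpha/2)|}.$$ Let $u:\mathbb R^n\to\mathbb R$ be a measurable function which is $\alpha$-harmonic, that is, $u\in L_\alpha$, meaning $$\int_{\mathbb R^n}\frac{|u(x)|}{1+|x|^{n+\alpha}}\,dx<\infty,$$ and $(-\Delta)^{\alpha/2}u=0$ in the sense of distributions, meaning $$\int_{\mathbb R^n}u(x)\,(-\Delta)^{\alpha/2}\phi(x)\,dx=0\qquad\text{for all }\phi\in C_c^\infty(\mathbb R^n).$$ Suppose that, for some $\gamma$ with $0\le\gamma\le1$ and $\gamma<\alpha$, $$\liminf_{|x|\to\infty}\frac{u(x)}{|x|^\gamma}\ge0,$$ where the lower limit may be taken in the essential sense, that is, ignoring sets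 of measure zero (this is implied by the same condition on the pointwise lower limit). Then there is a constant $C$ such that $u=C$ almost everywhere on $\mathbb R^n$; if $u$ is continuous, then $u(x)=C$ for every $x\in\mathbb R^n$. -/

import Mathlib

open MeasureTheory Filter Topology
open scoped ContDiff

noncomputable section

/-- The normalizing constant `2 ^ α Γ((n + α) / 2) / (π ^ (n / 2) |Γ(-α / 2)|)` of the fractional
Laplacian `(-Δ) ^ (α / 2)` on `ℝⁿ`. -/
def fracLaplacianConst (n : ℕ) (α : ℝ) : ℝ :=
  2 ^ α * Real.Gamma ((n + α) / 2) / (Real.pi ^ ((n : ℝ) / 2) * |Real.Gamma (-α / 2)|)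

/-- The fractional Laplacian `(-Δ) ^ (α / 2) φ (x)` as a principal value: the limit, as `ε → 0⁺`,
of the integrals over the complement of the ball of radius `ε` around `x`. -/
def fracLaplacian {n : ℕ} (α : ℝ) (φ : EuclideanSpace ℝ (Fin n) → ℝ)
    (x : EuclideanSpace ℝ (Fin n)) : ℝ :=
  fracLaplacianConst n α *
    limUnder (𝓝[>] (0 : ℝ)) fun ε : ℝ =>
      ∫ z in (Metric.ball x ε)ᶜ, (φ x - φ z) / ‖x - z‖ ^ ((n : ℝ) + α)

/-- The space `L_α` of the measurable functions `u` on `ℝⁿ` for which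
`|u(x)| / (1 + |x| ^ (n + α))` has finite integral. -/
def MemLAlpha {n : ℕ} (α : ℝ) (u : EuclideanSpace ℝ (Fin n) → ℝ) : Prop :=
  Integrable (fun x : EuclideanSpace ℝ (Fin n) => u x / (1 + ‖x‖ ^ ((n : ℝ) + α))) volume

/-- `u` is `α`-harmonic: `u ∈ L_α` and `(-Δ) ^ (α / 2) u = 0` in the sense of distributions. -/
structure IsAlphaHarmonic {n : ℕ} (α : ℝ) (u : EuclideanSpace ℝ (Fin n) → ℝ) : Prop where
  memLAlpha : MemLAlpha α u
  integral_eq_zero : ∀ φ : EuclideanSpace ℝ (Fin n) → ℝ, ContDiff ℝ ∞ φ → HasCompactSupport φ →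
    ∫ x, u x * fracLaplacian α φ x = 0

end

/-! Put q = n + α. The hypersingular integral of a Schwartz function is O((1+|x|)^(-q)), just the
decay that u ∈ L_α can be integrated against, so by density of C_c^∞ the equation for u may be
tested on all Schwartz functions. On the Fourier side the operator multiplies by a positive multiple
of |ξ|^α, which is invertible away from ξ = 0. Hence pairing u with η equals pairing u with the part
of η at frequencies |ξ| ≲ 1/c, for every c > 0 (`integral_smul_eq_integral_smul_fourierMultiplier`).

If η is replaced by a second difference of η, that difference can be moved onto the smoothing kernel
of width c, where it costs c^(-2); the low-frequency part is then O(c^(α-2)) in the weight dual to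
u. As α < 2, letting c → ∞ shows that all second differences of u vanish weakly
(`integral_smul_secondDiff_eq_zero`). This replaces the classical argument that the Fourier
transform of u lives at the origin, so that u is a polynomial.

Averages of u against translates of a bump by nh therefore form an arithmetic progression in n.
Since γ ≤ 1, the liminf condition gives u ≥ -ε|x| near infinity for each ε > 0, which excludes a
negative slope; using h and -h, the averages are translation invariant (`integral_mul_comp_sub_eq`).
Shrinking the bump and using Lebesgue points makes u constant. -/

/-! ### Second differences and second derivatives. -/

section SecondDifference

variable {E F : Type*} [NormedAddCommGroup E] [NormedSpace ℝ E] [NormedAddCommGroup F]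
  [NormedSpace ℝ F]

/-- The symmetric second difference `2 f(x) - f(x + y) - f(x - y)`. -/
def secondDiff (f : E → F) (x y : E) : F := (f x - f (x + y)) + (f x - f (x - y))

/-- The mean value inequality is used twice: the second difference is, up to sign, the increment
over [x - y, x] of z ↦ f(z + y) - f(z), whose derivative is itself an increment of `fderiv ℝ f`. -/
theorem norm_secondDiff_le {f : E → F} (hf : ContDiff ℝ 2 f) {x y : E} {M : ℝ}
    (h : ∀ z, ‖z - x‖ ≤ ‖y‖ → ‖fderiv ℝ (fderiv ℝ f) z‖ ≤ M) :
    ‖secondDiff f x y‖ ≤ M * ‖y‖ ^ 2 := by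
  have hf1 : Differentiable ℝ f := hf.differentiable (by norm_num)
  have hf2 : Differentiable ℝ (fderiv ℝ f) :=
    (hf.fderiv_right (m := 1) (by norm_num)).differentiable (by norm_num)
  have key : ∀ z ∈ segment ℝ (x - y) x, ‖fderiv ℝ f (z + y) - fderiv ℝ f z‖ ≤ M * ‖y‖ := by
    intro z hz
    have hsub : segment ℝ z (z + y) ⊆ Metric.closedBall x ‖y‖ := by
      obtain ⟨a, b, ha, hb, hab, rfl⟩ := hz
      refine (convex_closedBall x ‖y‖).segment_subset ?_ ?_
      · rw [mem_closedBall_iff_norm]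
        have : a • (x - y) + b • x - x = -(a • y) := by
          rw [show b = 1 - a by linarith]; module
        rw [this, norm_neg, norm_smul, Real.norm_of_nonneg ha]
        exact mul_le_of_le_one_left (norm_nonneg _) (by linarith)
      · rw [mem_closedBall_iff_norm]
        have : a • (x - y) + b • x + y - x = b • y := by
          rw [show b = 1 - a by linarith]; module
        rw [this, norm_smul, Real.norm_of_nonneg hb]
        exact mul_le_of_le_one_left (norm_nonneg _) (by linarith)
    have := (convex_segment z (z + y)).norm_image_sub_le_of_norm_fderiv_le (𝕜 := ℝ)
      (f := fderiv ℝ f) (C := M) (fun w _ => hf2 w)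
      (fun w hw => h w (mem_closedBall_iff_norm.1 (hsub hw)))
      (left_mem_segment ℝ z (z + y)) (right_mem_segment ℝ z (z + y))
    simpa using this
  have := (convex_segment (x - y) x).norm_image_sub_le_of_norm_hasFDerivWithin_le
      (f := fun z => f (z + y) - f z) (f' := fun z => fderiv ℝ f (z + y) - fderiv ℝ f z)
      (C := M * ‖y‖)
      (fun z _ => (((hasFDerivAt_comp_add_right y).2 (hf1 (z + y)).hasFDerivAt).sub
        (hf1 z).hasFDerivAt).hasFDerivWithinAt) key
      (right_mem_segment ℝ (x - y) x) (left_mem_segment ℝ (x - y) x)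
  have e : secondDiff f x y = f (x - y + y) - f (x - y) - (f (x + y) - f x) := by
    simp only [secondDiff, sub_add_cancel]; abel
  rw [e]
  refine this.trans (le_of_eq ?_)
  rw [show x - y - x = -y by abel, norm_neg]; ring

/-- For steps up to half of 1 + |x|, the weight at any point involved is at least half the weight at
x; hence the factor 2^N. -/
theorem norm_secondDiff_le_of_decay {f : E → F} (hf : ContDiff ℝ 2 f) {N : ℕ} {M : ℝ}
    (h2 : ∀ x, (1 + ‖x‖) ^ N * ‖fderiv ℝ (fderiv ℝ f) x‖ ≤ M) {x y : E}
    (hy : ‖y‖ ≤ (1 + ‖x‖) / 2) :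
    ‖secondDiff f x y‖ ≤ 2 ^ N * M / (1 + ‖x‖) ^ N * ‖y‖ ^ 2 := by
  refine norm_secondDiff_le hf fun z hz => ?_
  have hx : 0 < 1 + ‖x‖ := by positivity
  have hz' : (1 + ‖x‖) / 2 ≤ 1 + ‖z‖ := by
    have : ‖x‖ ≤ ‖z‖ + ‖z - x‖ := by
      rw [norm_sub_rev]; have := norm_add_le z (x - z); simpa using this
    linarith
  rw [le_div_iff₀ (by positivity)]
  have h3 : (1 + ‖x‖) ^ N ≤ 2 ^ N * (1 + ‖z‖) ^ N := by
    rw [← mul_pow]; gcongr; linarith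
  calc _ ≤ ‖fderiv ℝ (fderiv ℝ f) z‖ * (2 ^ N * (1 + ‖z‖) ^ N) := by gcongr
    _ = 2 ^ N * ((1 + ‖z‖) ^ N * ‖fderiv ℝ (fderiv ℝ f) z‖) := by ring
    _ ≤ _ := by gcongr; exact h2 z

end SecondDifference

/-! ### Powers of the norm inside and outside balls. -/

section RadialIntegrals

open Module

variable {E : Type*} [NormedAddCommGroup E] [NormedSpace ℝ E] [FiniteDimensional ℝ E]
  [Nontrivial E] [MeasurableSpace E] [BorelSpace E] (μ : Measure E) [μ.IsAddHaarMeasure]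

theorem integrable_norm_rpow_ball {s : ℝ} (hs : -(finrank ℝ E : ℝ) < s) :
    ∃ K : ℝ, 0 ≤ K ∧ ∀ ρ : ℝ, 0 < ρ →
      Integrable (fun y : E => (Set.Iic ρ).indicator (fun r : ℝ => r ^ s) ‖y‖) μ ∧
      ∫ y, (Set.Iic ρ).indicator (fun r : ℝ => r ^ s) ‖y‖ ∂μ = K * ρ ^ (finrank ℝ E + s) := by
  have hd : 0 < finrank ℝ E := finrank_pos
  have e : ∀ ρ : ℝ, Set.EqOn (fun r : ℝ => r ^ (finrank ℝ E - 1) •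
      (Set.Iic ρ).indicator (fun r : ℝ => r ^ s) r)
      ((Set.Iic ρ).indicator fun r : ℝ => r ^ (finrank ℝ E + s - 1)) (Set.Ioi 0) := by
    intro ρ r hr
    by_cases h : r ∈ Set.Iic ρ
    · simp only [Set.indicator_of_mem h, smul_eq_mul]
      rw [← Real.rpow_natCast, ← Real.rpow_add hr, Nat.cast_sub hd]
      congr 1; push_cast; ring
    · simp [Set.indicator_of_notMem h]
  have hpos : 0 < (finrank ℝ E : ℝ) + s := by linarith
  refine ⟨finrank ℝ E • (μ.real (Metric.ball 0 1) * (finrank ℝ E + s)⁻¹),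
    by positivity, fun ρ hρ => ⟨?_, ?_⟩⟩
  · rw [integrable_fun_norm_addHaar, integrableOn_congr_fun (e ρ) measurableSet_Ioi,
      integrableOn_indicator_iff measurableSet_Iic, Set.inter_comm, Set.Ioi_inter_Iic,
      ← intervalIntegrable_iff_integrableOn_Ioc_of_le hρ.le]
    exact intervalIntegral.intervalIntegrable_rpow' (by linarith)
  · rw [integral_fun_norm_addHaar, setIntegral_congr_fun measurableSet_Ioi (e ρ),
      setIntegral_indicator measurableSet_Iic, Set.Ioi_inter_Iic,
      ← intervalIntegral.integral_of_le hρ.le, integral_rpow (Or.inl (by linarith))]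
    rw [show (finrank ℝ E : ℝ) + s - 1 + 1 = finrank ℝ E + s by ring,
      Real.zero_rpow hpos.ne']
    simp only [smul_eq_mul, nsmul_eq_mul]
    field_simp
    ring

theorem integrable_norm_rpow_compl_ball {s : ℝ} (hs : s < -(finrank ℝ E : ℝ)) :
    ∃ K : ℝ, 0 ≤ K ∧ ∀ ρ : ℝ, 0 < ρ →
      Integrable (fun y : E => (Set.Ioi ρ).indicator (fun r : ℝ => r ^ s) ‖y‖) μ ∧
      ∫ y, (Set.Ioi ρ).indicator (fun r : ℝ => r ^ s) ‖y‖ ∂μ = K * ρ ^ (finrank ℝ E + s) := by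
  have hd : 0 < finrank ℝ E := finrank_pos
  have e : ∀ ρ : ℝ, Set.EqOn (fun r : ℝ => r ^ (finrank ℝ E - 1) •
      (Set.Ioi ρ).indicator (fun r : ℝ => r ^ s) r)
      ((Set.Ioi ρ).indicator fun r : ℝ => r ^ (finrank ℝ E + s - 1)) (Set.Ioi 0) := by
    intro ρ r hr
    by_cases h : r ∈ Set.Ioi ρ
    · simp only [Set.indicator_of_mem h, smul_eq_mul]
      rw [← Real.rpow_natCast, ← Real.rpow_add hr, Nat.cast_sub hd]
      congr 1; push_cast; ring
    · simp [Set.indicator_of_notMem h]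
  have hneg : (finrank ℝ E : ℝ) + s < 0 := by linarith
  refine ⟨finrank ℝ E • (μ.real (Metric.ball 0 1) * (-(finrank ℝ E + s))⁻¹),
    ?_, fun ρ hρ => ⟨?_, ?_⟩⟩
  · have : 0 < -((finrank ℝ E : ℝ) + s) := by linarith
    positivity
  · rw [integrable_fun_norm_addHaar, integrableOn_congr_fun (e ρ) measurableSet_Ioi,
      integrableOn_indicator_iff measurableSet_Ioi, Set.Ioi_inter_Ioi, sup_eq_left.2 hρ.le]
    exact integrableOn_Ioi_rpow_of_lt (by linarith) hρ
  · rw [integral_fun_norm_addHaar, setIntegral_congr_fun measurableSet_Ioi (e ρ),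
      setIntegral_indicator measurableSet_Ioi, Set.Ioi_inter_Ioi, sup_eq_right.2 hρ.le,
      integral_Ioi_rpow_of_lt (by linarith) hρ]
    rw [show (finrank ℝ E : ℝ) + s - 1 + 1 = finrank ℝ E + s by ring]
    simp only [smul_eq_mul, nsmul_eq_mul]
    have : -((finrank ℝ E : ℝ) + s) ≠ 0 := by linarith
    have : ((finrank ℝ E : ℝ) + s) ≠ 0 := by linarith
    rw [inv_neg]
    ring

end RadialIntegrals

/-! ### Weighted decay of the hypersingular integral. -/

section HypersingularIntegral

open Module

theorem norm_le_of_decay {E F : Type*} [NormedAddCommGroup E] [NormedAddCommGroup F] {f : E → F}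
    {N : ℕ} {M : ℝ} (h0 : ∀ x, (1 + ‖x‖) ^ N * ‖f x‖ ≤ M) (x : E) :
    ‖f x‖ ≤ M * ((1 + ‖x‖) ^ N)⁻¹ := by
  rw [← div_eq_mul_inv, le_div_iff₀ (by positivity), mul_comm]; exact h0 x

variable {E F : Type*} [NormedAddCommGroup E] [NormedSpace ℝ E] [FiniteDimensional ℝ E]
  [MeasurableSpace E] [BorelSpace E] [NormedAddCommGroup F]

theorem integrable_one_add_norm_pow_neg (μ : Measure E) [μ.IsAddHaarMeasure] :
    Integrable (fun x : E => ((1 + ‖x‖) ^ (finrank ℝ E + 2))⁻¹) μ := by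
  have := integrable_one_add_norm (E := E) (μ := μ) (r := (finrank ℝ E + 2 : ℕ))
    (by push_cast; linarith)
  refine this.congr (Eventually.of_forall fun x => ?_)
  simp only
  rw [Real.rpow_neg (by positivity), Real.rpow_natCast]

theorem integrable_of_decay (μ : Measure E) [μ.IsAddHaarMeasure] {f : E → F} (hf : Continuous f)
    {M : ℝ} (h0 : ∀ x, (1 + ‖x‖) ^ (finrank ℝ E + 2) * ‖f x‖ ≤ M) :
    Integrable f μ :=
  ((integrable_one_add_norm_pow_neg μ).const_mul M).mono' hf.aestronglyMeasurable
    (Eventually.of_forall (norm_le_of_decay h0))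

/-- Split at |y| = w/2 with w = 1 + |x|. The near part costs w^(-d-2) · w^(d+2-q), the far part of
the f(x) terms w^(-d-2) · w^(d-q), and the shifted terms w^(-q) times the L¹ norm of f. All are
O(w^(-q)), with a constant independent of f; this dictates the weight d + 2. -/
theorem exists_hypersingular_bound [Nontrivial E] [NormedSpace ℝ F] (μ : Measure E) [μ.IsAddHaarMeasure] {q : ℝ}
    (hq : (finrank ℝ E : ℝ) < q) (hq2 : q < finrank ℝ E + 2) :
    ∃ C : ℝ, 0 ≤ C ∧ ∀ (f : E → F) (M : ℝ), ContDiff ℝ 2 f →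
      (∀ x, (1 + ‖x‖) ^ (finrank ℝ E + 2) * ‖f x‖ ≤ M) →
      (∀ x, (1 + ‖x‖) ^ (finrank ℝ E + 2) * ‖fderiv ℝ (fderiv ℝ f) x‖ ≤ M) →
      ∀ x, Integrable (fun y => (‖y‖ ^ q)⁻¹ • secondDiff f x y) μ ∧
        ‖∫ y, (‖y‖ ^ q)⁻¹ • secondDiff f x y ∂μ‖ ≤ C * M * (1 + ‖x‖) ^ (-q) := by
  obtain ⟨K₁, hK₁, h₁⟩ := integrable_norm_rpow_ball μ (s := 2 - q) (by linarith)
  obtain ⟨K₂, hK₂, h₂⟩ := integrable_norm_rpow_compl_ball μ (s := -q) (by linarith)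
  set d := finrank ℝ E with hd
  set J := ∫ x : E, ((1 + ‖x‖) ^ (d + 2))⁻¹ ∂μ with hJ
  have hJ0 : 0 ≤ J := integral_nonneg fun x => by positivity
  have hq0 : 0 < q := lt_of_le_of_lt (Nat.cast_nonneg _) hq
  refine ⟨2 ^ (d + 2) * K₁ * (1 / 2) ^ (d + (2 - q)) + 2 * K₂ * (1 / 2) ^ (d + -q) +
    (1 / 2) ^ (-q) * (2 * J), by positivity, fun f M hf hf0 hf2 x => ?_⟩
  have hM : 0 ≤ M := le_trans (by positivity) (hf0 0)
  set w : ℝ := 1 + ‖x‖ with hw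
  have hw1 : 1 ≤ w := by simp [hw]
  have hw0 : 0 < w := by linarith
  have hint : Integrable f μ := integrable_of_decay μ hf.continuous hf0
  have hfJ : ∫ y, ‖f y‖ ∂μ ≤ M * J := by
    rw [hJ, ← integral_const_mul]
    exact integral_mono hint.norm ((integrable_one_add_norm_pow_neg μ).const_mul M)
      (norm_le_of_decay hf0)
  have hi1 : Integrable (fun y => ‖f (x + y)‖) μ := (hint.comp_add_left x).norm
  have hi2 : Integrable (fun y => ‖f (x - y)‖) μ := (hint.comp_sub_left x).norm
  have hj1 : ∫ y, ‖f (x + y)‖ ∂μ = ∫ y, ‖f y‖ ∂μ := integral_add_left_eq_self (fun y => ‖f y‖) x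
  have hj2 : ∫ y, ‖f (x - y)‖ ∂μ = ∫ y, ‖f y‖ ∂μ := integral_sub_left_eq_self (fun y => ‖f y‖) μ x
  have hρ : 0 < w / 2 := by positivity
  obtain ⟨h₁i, h₁e⟩ := h₁ (w / 2) hρ
  obtain ⟨h₂i, h₂e⟩ := h₂ (w / 2) hρ
  set g : E → ℝ := fun y =>
    2 ^ (d + 2) * M / w ^ (d + 2) * (Set.Iic (w / 2)).indicator (fun r : ℝ => r ^ (2 - q)) ‖y‖ +
    2 * M / w ^ (d + 2) * (Set.Ioi (w / 2)).indicator (fun r : ℝ => r ^ (-q)) ‖y‖ +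
    (w / 2) ^ (-q) * (‖f (x + y)‖ + ‖f (x - y)‖) with hg
  have a₁ := h₁i.const_mul (2 ^ (d + 2) * M / w ^ (d + 2))
  have a₂ := h₂i.const_mul (2 * M / w ^ (d + 2))
  have a₃ : Integrable (fun y => (w / 2) ^ (-q) * (‖f (x + y)‖ + ‖f (x - y)‖)) μ :=
    (hi1.add hi2).const_mul _
  have a₁₂ : Integrable (fun y =>
      2 ^ (d + 2) * M / w ^ (d + 2) * (Set.Iic (w / 2)).indicator (fun r : ℝ => r ^ (2 - q)) ‖y‖ +
      2 * M / w ^ (d + 2) * (Set.Ioi (w / 2)).indicator (fun r : ℝ => r ^ (-q)) ‖y‖) μ := a₁.add a₂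
  have hgi : Integrable g μ := a₁₂.add a₃
  have hge : ∫ y, g y ∂μ = 2 ^ (d + 2) * M / w ^ (d + 2) * (K₁ * (w / 2) ^ (d + (2 - q))) +
      2 * M / w ^ (d + 2) * (K₂ * (w / 2) ^ (d + -q)) +
      (w / 2) ^ (-q) * (2 * ∫ y, ‖f y‖ ∂μ) := by
    rw [hg, integral_add a₁₂ a₃, integral_add a₁ a₂, integral_const_mul, integral_const_mul,
      integral_const_mul, integral_add hi1 hi2, h₁e, h₂e, hj1, hj2, two_mul (∫ y, ‖f y‖ ∂μ)]
  have hle : ∀ y, ‖(‖y‖ ^ q)⁻¹ • secondDiff f x y‖ ≤ g y := by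
    intro y
    rw [norm_smul, Real.norm_of_nonneg (by positivity)]
    rcases le_or_gt ‖y‖ (w / 2) with hy | hy
    · have hb := norm_secondDiff_le_of_decay hf hf2 hy
      rw [hg]
      simp only [Set.indicator_of_mem (Set.mem_Iic.2 hy),
        Set.indicator_of_notMem (show ‖y‖ ∉ Set.Ioi (w / 2) from not_lt.2 hy), mul_zero, add_zero]
      rcases (norm_nonneg y).eq_or_lt with h0 | h0
      · rw [← h0, Real.zero_rpow hq0.ne', inv_zero, zero_mul]
        have := Real.rpow_nonneg (le_refl (0 : ℝ)) (2 - q)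
        positivity
      · have e : ‖y‖ ^ (2 - q) = (‖y‖ ^ q)⁻¹ * ‖y‖ ^ 2 := by
          rw [sub_eq_add_neg, Real.rpow_add h0, Real.rpow_neg h0.le, mul_comm]; norm_num
        rw [e]
        have : 0 ≤ (w / 2) ^ (-q) * (‖f (x + y)‖ + ‖f (x - y)‖) := by positivity
        calc _ ≤ (‖y‖ ^ q)⁻¹ * (2 ^ (d + 2) * M / w ^ (d + 2) * ‖y‖ ^ 2) := by gcongr
          _ = 2 ^ (d + 2) * M / w ^ (d + 2) * ((‖y‖ ^ q)⁻¹ * ‖y‖ ^ 2) := by ring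
          _ ≤ _ := by linarith
    · rw [hg]
      simp only [Set.indicator_of_mem (Set.mem_Ioi.2 hy),
        Set.indicator_of_notMem (show ‖y‖ ∉ Set.Iic (w / 2) from not_le.2 hy), mul_zero, zero_add]
      have h0 : 0 < ‖y‖ := hρ.trans hy
      have hb : ‖secondDiff f x y‖ ≤ 2 * (M * (w ^ (d + 2))⁻¹) + (‖f (x + y)‖ + ‖f (x - y)‖) := by
        have h1 := norm_sub_le (f x) (f (x + y))
        have h2 := norm_sub_le (f x) (f (x - y))
        have h3 := norm_add_le (f x - f (x + y)) (f x - f (x - y))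
        have h4 := norm_le_of_decay hf0 x
        unfold secondDiff; linarith
      have hc : (‖y‖ ^ q)⁻¹ ≤ (w / 2) ^ (-q) := by
        rw [← Real.rpow_neg h0.le]
        exact Real.rpow_le_rpow_of_nonpos hρ hy.le (by linarith)
      calc _ ≤ (‖y‖ ^ q)⁻¹ * (2 * (M * (w ^ (d + 2))⁻¹) + (‖f (x + y)‖ + ‖f (x - y)‖)) := by gcongr
        _ = 2 * M / w ^ (d + 2) * ‖y‖ ^ (-q) + (‖y‖ ^ q)⁻¹ * (‖f (x + y)‖ + ‖f (x - y)‖) := by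
          rw [Real.rpow_neg h0.le]; ring
        _ ≤ _ := by gcongr
  have hmeas : AEStronglyMeasurable (fun y => (‖y‖ ^ q)⁻¹ • secondDiff f x y) μ := by
    refine AEStronglyMeasurable.smul (Measurable.aestronglyMeasurable (by fun_prop)) ?_
    have := hf.continuous
    exact Continuous.aestronglyMeasurable (by unfold secondDiff; fun_prop)
  refine ⟨hgi.mono' hmeas (Eventually.of_forall hle), ?_⟩
  refine (norm_integral_le_of_norm_le hgi (Eventually.of_forall hle)).trans ?_
  rw [hge]
  have hs : ∀ a : ℝ, (w / 2) ^ a = w ^ a * (1 / 2) ^ a := fun a => by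
    rw [← Real.mul_rpow hw0.le (by norm_num)]; congr 1; ring
  rw [hs, hs, hs]
  have e1 : w ^ ((d : ℝ) + (2 - q)) / w ^ (d + 2) = w ^ (-q) := by
    rw [← Real.rpow_natCast w, ← Real.rpow_sub hw0]; congr 1; push_cast; ring
  have e2 : w ^ ((d : ℝ) + -q) / w ^ (d + 2) ≤ w ^ (-q) := by
    rw [← e1]
    exact div_le_div_of_nonneg_right (Real.rpow_le_rpow_of_exponent_le hw1 (by linarith))
      (by positivity)
  calc _ = 2 ^ (d + 2) * K₁ * (1 / 2) ^ (d + (2 - q)) * M * (w ^ ((d : ℝ) + (2 - q)) / w ^ (d + 2)) +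
        2 * K₂ * (1 / 2) ^ (d + -q) * M * (w ^ ((d : ℝ) + -q) / w ^ (d + 2)) +
        (1 / 2) ^ (-q) * (2 * ∫ y, ‖f y‖ ∂μ) * w ^ (-q) := by ring
    _ ≤ 2 ^ (d + 2) * K₁ * (1 / 2) ^ (d + (2 - q)) * M * w ^ (-q) +
        2 * K₂ * (1 / 2) ^ (d + -q) * M * w ^ (-q) +
        (1 / 2) ^ (-q) * (2 * (M * J)) * w ^ (-q) := by
      rw [e1]; gcongr
    _ = _ := by ring

end HypersingularIntegral

/-! ### Density of compactly supported functions in Schwartz space. -/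

section Density

open scoped SchwartzMap

variable {E F : Type*} [NormedAddCommGroup E] [InnerProductSpace ℝ E] [FiniteDimensional ℝ E]
  [NormedAddCommGroup F] [NormedSpace ℝ F]

theorem ContDiffBump.exists_norm_iteratedFDeriv_sub_one_le (χ : ContDiffBump (0 : E)) (i : ℕ) :
    ∃ B : ℝ, ∀ x, ‖iteratedFDeriv ℝ i (fun x => χ x - 1) x‖ ≤ B := by
  rcases i with _ | i
  · refine ⟨1, fun x => ?_⟩
    rw [norm_iteratedFDeriv_zero, Real.norm_eq_abs, abs_le]
    constructor <;> linarith [χ.nonneg' x, χ.le_one (x := x)]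
  · have hs : ContDiff ℝ ((i + 1 : ℕ) : WithTop ℕ∞) χ := χ.contDiff
    obtain ⟨B, hB⟩ := (hs.continuous_iteratedFDeriv le_rfl).bounded_above_of_compact_support
      (χ.hasCompactSupport.iteratedFDeriv (𝕜 := ℝ) (i + 1))
    refine ⟨B, fun x => ?_⟩
    have : iteratedFDeriv ℝ (i + 1) (fun x => χ x - 1) x = iteratedFDeriv ℝ (i + 1) χ x := by
      have := iteratedFDeriv_sub_apply (𝕜 := ℝ) (i := i + 1) (f := χ) (g := fun _ => (1 : ℝ)) (x := x)
        hs.contDiffAt contDiff_const.contDiffAt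
      rw [iteratedFDeriv_const_of_ne (by omega)] at this
      rw [Pi.zero_apply, sub_zero] at this
      exact this
    rw [this]; exact hB x

theorem SchwartzMap.dense_hasCompactSupport :
    Dense {φ : 𝓢(E, F) | HasCompactSupport φ} := by
  intro φ
  let χ : ContDiffBump (0 : E) := ⟨1, 2, by norm_num, by norm_num⟩
  let c : ℕ → ℝ := fun k => 1 / ((k : ℝ) + 1)
  have hc0 : ∀ k, 0 < c k := fun k => by positivity
  have hc1 : ∀ k, c k ≤ 1 := fun k => by
    rw [div_le_one (by positivity)]; linarith [(Nat.cast_nonneg k : (0 : ℝ) ≤ k)]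
  let g : ℕ → E → ℝ := fun k x => χ (c k • x)
  have hgs : ∀ k, ContDiff ℝ ∞ (g k) := fun k => χ.contDiff.comp (contDiff_const_smul (c k))
  have hgc : ∀ k, HasCompactSupport (g k) := fun k =>
    χ.hasCompactSupport.comp_homeomorph (Homeomorph.smulOfNeZero (c k) (hc0 k).ne')
  have hgt : ∀ k, (g k).HasTemperateGrowth := fun k => (hgc k).hasTemperateGrowth (hgs k)
  have hmem : ∀ k, SchwartzMap.smulLeftCLM F (g k) φ ∈ {φ : 𝓢(E, F) | HasCompactSupport φ} := by
    intro k
    have : ⇑(SchwartzMap.smulLeftCLM F (g k) φ) = g k • ⇑φ := by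
      ext x; rw [SchwartzMap.smulLeftCLM_apply_apply (hgt k)]; rfl
    simp only [Set.mem_ofPred_eq, this]
    exact (hgc k).smul_right
  refine mem_closure_of_tendsto (b := atTop) ?_ (Eventually.of_forall hmem)
  rw [(schwartz_withSeminorms ℝ E F).tendsto_nhds]
  choose B hB using χ.exists_norm_iteratedFDeriv_sub_one_le
  rintro ⟨N, m⟩ ε hε
  let K : ℝ := ∑ i ∈ Finset.range (m + 1), (m.choose i : ℝ) * B i *
    SchwartzMap.seminorm ℝ (N + 1) (m - i) φ
  have hB0 : ∀ i, 0 ≤ B i := fun i => (norm_nonneg _).trans (hB i 0)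
  have hK : 0 ≤ K := Finset.sum_nonneg fun i _ => by have := hB0 i; positivity
  have hbound : ∀ k, SchwartzMap.seminorm ℝ N m (SchwartzMap.smulLeftCLM F (g k) φ - φ) ≤
      c k * K := by
    intro k
    refine SchwartzMap.seminorm_le_bound ℝ N m _ (mul_nonneg (hc0 k).le hK) fun x => ?_
    let h : E → ℝ := fun x => χ (c k • x) - 1
    have hcoe : ⇑(SchwartzMap.smulLeftCLM F (g k) φ - φ) = fun x => h x • φ x := by
      ext x
      rw [sub_apply, SchwartzMap.smulLeftCLM_apply_apply (hgt k)]
      simp [h, g, sub_smul]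
    have hh : ContDiff ℝ ∞ h := (hgs k).sub contDiff_const
    rw [hcoe]
    rcases lt_or_ge ‖c k • x‖ 1 with hx | hx
    · have : (fun x => h x • φ x) =ᶠ[𝓝 x] fun _ => 0 := by
        have ho : IsOpen {x : E | ‖c k • x‖ < 1} := isOpen_lt (by fun_prop) (by fun_prop)
        filter_upwards [ho.mem_nhds hx] with z hz
        have : χ (c k • z) = 1 := χ.one_of_mem_closedBall (by simpa using le_of_lt hz)
        simp [h, this]
      rw [(this.iteratedFDeriv ℝ m).eq_of_nhds]
      simp only [iteratedFDeriv_fun_zero, Pi.zero_apply, norm_zero, mul_zero]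
      exact mul_nonneg (hc0 k).le hK
    -- The cutoff error lives where c|x| ≥ 1, so one extra power of |x|, absorbed by the seminorm of
    -- order N + 1, buys the small factor c.
    · have hx' : 1 ≤ c k * ‖x‖ := by
        rwa [norm_smul, Real.norm_of_nonneg (hc0 k).le] at hx
      have hd : ∀ i, ‖iteratedFDeriv ℝ i h x‖ ≤ B i := by
        intro i
        have hχ : ContDiff ℝ ∞ (fun x : E => χ x - 1) := χ.contDiff.sub contDiff_const
        have := (c k • ContinuousLinearMap.id ℝ E).iteratedFDeriv_comp_right hχ x
          (i := i) (by exact_mod_cast le_top)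
        have e : (fun x : E => χ x - 1) ∘ ⇑(c k • ContinuousLinearMap.id ℝ E) = h := by
          ext x; simp [h]
        rw [e] at this
        rw [this]
        refine (ContinuousMultilinearMap.norm_compContinuousLinearMap_le _ _).trans ?_
        refine (mul_le_of_le_one_right (norm_nonneg _) (Finset.prod_le_one (fun _ _ => norm_nonneg _)
          fun _ _ => ?_)).trans (hB i _)
        rw [norm_smul, Real.norm_of_nonneg (hc0 k).le]
        exact mul_le_one₀ (hc1 k) (norm_nonneg _) ContinuousLinearMap.norm_id_le
      have h1 := norm_iteratedFDeriv_smul_le (𝕜 := ℝ) (f := h) (g := φ) (N := ∞)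
        hh (φ.smooth ⊤) x (n := m) (by exact_mod_cast le_top)
      calc ‖x‖ ^ N * ‖iteratedFDeriv ℝ m (fun x => h x • φ x) x‖
          ≤ ‖x‖ ^ N * ∑ i ∈ Finset.range (m + 1), (m.choose i : ℝ) * ‖iteratedFDeriv ℝ i h x‖ *
              ‖iteratedFDeriv ℝ (m - i) φ x‖ := by gcongr
        _ ≤ ‖x‖ ^ N * (c k * ‖x‖) * ∑ i ∈ Finset.range (m + 1), (m.choose i : ℝ) * B i *
              ‖iteratedFDeriv ℝ (m - i) φ x‖ := by
            gcongr
            · exact le_mul_of_one_le_right (by positivity) hx'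
            · exact hd _
        _ = c k * ∑ i ∈ Finset.range (m + 1), (m.choose i : ℝ) * B i *
              (‖x‖ ^ (N + 1) * ‖iteratedFDeriv ℝ (m - i) φ x‖) := by
            rw [Finset.mul_sum, Finset.mul_sum]
            exact Finset.sum_congr rfl fun i _ => by ring
        _ ≤ c k * K := by
            refine mul_le_mul_of_nonneg_left (Finset.sum_le_sum fun i _ => ?_) (hc0 k).le
            exact mul_le_mul_of_nonneg_left (φ.le_seminorm ℝ (N + 1) (m - i) x)
              (mul_nonneg (Nat.cast_nonneg _) (hB0 i))
  have hlim : Tendsto (fun k => c k * K) atTop (𝓝 0) := by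
    simpa [c] using (tendsto_one_div_add_atTop_nhds_zero_nat (𝕜 := ℝ)).mul_const K
  filter_upwards [hlim.eventually_lt_const hε] with k hk
  exact (hbound k).trans_lt hk

end Density

/-! ### Pairings with u as continuous functionals on Schwartz space. -/

section WeightedFunctional

open Module
open scoped SchwartzMap

variable {E F : Type*} [NormedAddCommGroup E] [InnerProductSpace ℝ E]
  [NormedAddCommGroup F] [NormedSpace ℝ F]

/-- A Schwartz seminorm controlling `f` and its second derivative with weight
`(1 + |x|) ^ (dim E + 2)`. -/
noncomputable def SchwartzMap.weightedNorm (f : 𝓢(E, F)) : ℝ :=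
  2 ^ (finrank ℝ E + 2) *
    (Finset.Iic (finrank ℝ E + 2, 2)).sup (schwartzSeminormFamily ℝ E F) f

namespace SchwartzMap

theorem one_add_pow_mul_norm_le (f : 𝓢(E, F)) (x : E) :
    (1 + ‖x‖) ^ (finrank ℝ E + 2) * ‖f x‖ ≤ f.weightedNorm := by
  rw [← norm_iteratedFDeriv_zero (𝕜 := ℝ)]
  exact one_add_le_sup_seminorm_apply (𝕜 := ℝ) (m := (finrank ℝ E + 2, 2)) le_rfl
    (Nat.zero_le 2) f x

theorem one_add_pow_mul_norm_fderiv_fderiv_le (f : 𝓢(E, F)) (x : E) :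
    (1 + ‖x‖) ^ (finrank ℝ E + 2) * ‖fderiv ℝ (fderiv ℝ f) x‖ ≤ f.weightedNorm := by
  rw [← norm_iteratedFDeriv_one, norm_iteratedFDeriv_fderiv]
  exact one_add_le_sup_seminorm_apply (𝕜 := ℝ) (m := (finrank ℝ E + 2, 2)) le_rfl
    le_rfl f x

theorem norm_le_weightedNorm_rpow {q : ℝ} (hq2 : q ≤ finrank ℝ E + 2) (f : 𝓢(E, F)) (x : E) :
    ‖f x‖ ≤ f.weightedNorm * (1 + ‖x‖) ^ (-q) := by
  have h0 : 0 ≤ f.weightedNorm := le_trans (by positivity) (f.one_add_pow_mul_norm_le 0)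
  refine (norm_le_of_decay f.one_add_pow_mul_norm_le x).trans ?_
  rw [← Real.rpow_natCast, ← Real.rpow_neg (by positivity)]
  refine mul_le_mul_of_nonneg_left (Real.rpow_le_rpow_of_exponent_le (by simp) ?_) h0
  push_cast; linarith

end SchwartzMap

variable [FiniteDimensional ℝ E] [MeasurableSpace E] [BorelSpace E]

/-- The hypersingular integral `∫ (2 f(x) - f(x + y) - f(x - y)) / |y| ^ q dy`. -/
noncomputable def hypersingular (q : ℝ) (f : E → F) (x : E) : F :=
  ∫ y : E, (‖y‖ ^ q)⁻¹ • secondDiff f x y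

namespace SchwartzMap

variable {q : ℝ}

theorem exists_norm_hypersingular_le [Nontrivial E] (F : Type*) [NormedAddCommGroup F] [NormedSpace ℝ F]
    (hq : (finrank ℝ E : ℝ) < q) (hq2 : q < finrank ℝ E + 2) :
    ∃ C : ℝ, 0 ≤ C ∧ ∀ (f : 𝓢(E, F)) (x : E),
      ‖hypersingular q f x‖ ≤ C * f.weightedNorm * (1 + ‖x‖) ^ (-q) := by
  obtain ⟨C, hC, h⟩ := exists_hypersingular_bound (E := E) (F := F) volume hq hq2
  exact ⟨C, hC, fun f x => (h f f.weightedNorm (f.smooth 2) f.one_add_pow_mul_norm_le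
    f.one_add_pow_mul_norm_fderiv_fderiv_le x).2⟩

theorem integrable_secondDiff [Nontrivial E] (hq : (finrank ℝ E : ℝ) < q) (hq2 : q < finrank ℝ E + 2)
    (f : 𝓢(E, F)) (x : E) : Integrable (fun y => (‖y‖ ^ q)⁻¹ • secondDiff f x y) := by
  obtain ⟨C, hC, h⟩ := exists_hypersingular_bound (E := E) (F := F) volume hq hq2
  exact (h f f.weightedNorm (f.smooth 2) f.one_add_pow_mul_norm_le
    f.one_add_pow_mul_norm_fderiv_fderiv_le x).1

theorem aestronglyMeasurable_hypersingular (f : 𝓢(E, F)) :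
    AEStronglyMeasurable (hypersingular q f) (volume : Measure E) := by
  have hc : Continuous fun p : E × E => secondDiff f p.1 p.2 := by
    unfold secondDiff; fun_prop
  have hm : Measurable fun p : E × E => (‖p.2‖ ^ q)⁻¹ := by fun_prop
  exact (hm.stronglyMeasurable.smul hc.stronglyMeasurable).integral_prod_right.aestronglyMeasurable

theorem hypersingular_add [Nontrivial E] (hq : (finrank ℝ E : ℝ) < q) (hq2 : q < finrank ℝ E + 2)
    (f g : 𝓢(E, F)) (x : E) :
    hypersingular q ⇑(f + g) x = hypersingular q f x + hypersingular q g x := by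
  unfold hypersingular
  rw [← integral_add (integrable_secondDiff hq hq2 f x) (integrable_secondDiff hq hq2 g x)]
  refine integral_congr_ae (Eventually.of_forall fun y => ?_)
  simp only [secondDiff, add_apply, ← smul_add]
  congr 1; abel

theorem hypersingular_smul (c : ℝ) (f : 𝓢(E, F)) (x : E) :
    hypersingular q ⇑(c • f) x = c • hypersingular q f x := by
  unfold hypersingular
  rw [← integral_smul]
  refine integral_congr_ae (Eventually.of_forall fun y => ?_)
  simp only [secondDiff, smul_apply, ← smul_sub, ← smul_add]
  rw [smul_comm]

end SchwartzMap

/-- Duality between weighted L¹ and weighted L^∞; every later estimate on a pairing with u passes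
through it. -/
theorem integrable_smul_of_norm_le {q : ℝ} {u : E → ℝ} {g : E → F}
    (hu : Integrable fun x => u x * (1 + ‖x‖) ^ (-q))
    (hg : AEStronglyMeasurable g) {C : ℝ} (hC : ∀ x, ‖g x‖ ≤ C * (1 + ‖x‖) ^ (-q)) :
    Integrable (fun x => u x • g x) ∧
      ‖∫ x, u x • g x‖ ≤ C * ∫ x, |u x * (1 + ‖x‖) ^ (-q)| := by
  have hw : ∀ x : E, 0 < (1 + ‖x‖) ^ (-q) := fun x => Real.rpow_pos_of_pos (by positivity) _
  have hum : AEStronglyMeasurable u (volume : Measure E) := by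
    have hm : Measurable fun x : E => (1 + ‖x‖) ^ q := by fun_prop
    refine (hu.aestronglyMeasurable.mul hm.aestronglyMeasurable).congr
      (Eventually.of_forall fun x => ?_)
    simp only [Pi.mul_apply]
    rw [mul_assoc, ← Real.rpow_add (by positivity)]; simp
  have hle : ∀ x, ‖u x • g x‖ ≤ C * |u x * (1 + ‖x‖) ^ (-q)| := fun x => by
    rw [norm_smul, abs_mul, abs_of_pos (hw x), Real.norm_eq_abs]
    calc _ ≤ |u x| * (C * (1 + ‖x‖) ^ (-q)) := by gcongr; exact hC x
      _ = _ := by ring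
  refine ⟨(hu.abs.const_mul C).mono' (hum.smul hg) (Eventually.of_forall hle), ?_⟩
  rw [← integral_const_mul]
  exact norm_integral_le_of_norm_le (hu.abs.const_mul C) (Eventually.of_forall hle)

namespace SchwartzMap

variable {q : ℝ} {u : E → ℝ}

theorem integrable_smul (hq2 : q ≤ finrank ℝ E + 2)
    (hu : Integrable fun x => u x * (1 + ‖x‖) ^ (-q)) (f : 𝓢(E, F)) :
    Integrable fun x => u x • f x :=
  (integrable_smul_of_norm_le hu f.continuous.aestronglyMeasurable
    (f.norm_le_weightedNorm_rpow hq2)).1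

theorem integrable_smul_hypersingular [Nontrivial E] (hq : (finrank ℝ E : ℝ) < q)
    (hq2 : q < finrank ℝ E + 2)
    (hu : Integrable fun x => u x * (1 + ‖x‖) ^ (-q)) (f : 𝓢(E, F)) :
    Integrable fun x => u x • hypersingular q f x := by
  obtain ⟨C, hC, h⟩ := exists_norm_hypersingular_le F hq hq2
  exact (integrable_smul_of_norm_le hu f.aestronglyMeasurable_hypersingular (h f)).1

theorem continuous_integral_smul (hq2 : q ≤ finrank ℝ E + 2)
    (hu : Integrable fun x => u x * (1 + ‖x‖) ^ (-q)) :
    Continuous fun f : 𝓢(E, F) => ∫ x, u x • f x := by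
  refine (mkCLMtoNormedSpace (𝕜 := ℝ) (𝕜' := ℝ) (σ := RingHom.id ℝ)
    (fun f : 𝓢(E, F) => ∫ x, u x • f x) ?_ ?_
    ⟨Finset.Iic (finrank ℝ E + 2, 2), 2 ^ (finrank ℝ E + 2) * ∫ x, |u x * (1 + ‖x‖) ^ (-q)|,
      by positivity, fun f => ?_⟩).continuous
  · intro f g
    rw [← integral_add (f.integrable_smul hq2 hu) (g.integrable_smul hq2 hu)]
    simp
  · intro a f
    rw [RingHom.id_apply, ← integral_smul]
    simp [smul_comm a]
  · refine (integrable_smul_of_norm_le hu f.continuous.aestronglyMeasurable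
      (f.norm_le_weightedNorm_rpow hq2)).2.trans (le_of_eq ?_)
    unfold weightedNorm; ring

theorem continuous_integral_smul_hypersingular [Nontrivial E] (hq : (finrank ℝ E : ℝ) < q)
    (hq2 : q < finrank ℝ E + 2)
    (hu : Integrable fun x => u x * (1 + ‖x‖) ^ (-q)) :
    Continuous fun f : 𝓢(E, F) => ∫ x, u x • hypersingular q f x := by
  obtain ⟨C, hC, h⟩ := exists_norm_hypersingular_le F hq hq2
  refine (mkCLMtoNormedSpace (𝕜 := ℝ) (𝕜' := ℝ) (σ := RingHom.id ℝ)
    (fun f : 𝓢(E, F) => ∫ x, u x • hypersingular q f x) ?_ ?_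
    ⟨Finset.Iic (finrank ℝ E + 2, 2), C * 2 ^ (finrank ℝ E + 2) *
      ∫ x, |u x * (1 + ‖x‖) ^ (-q)|, by positivity, fun f => ?_⟩).continuous
  · intro f g
    rw [← integral_add (f.integrable_smul_hypersingular hq hq2 hu)
      (g.integrable_smul_hypersingular hq hq2 hu)]
    simp only [hypersingular_add hq hq2, smul_add]
  · intro a f
    rw [RingHom.id_apply, ← integral_smul]
    simp only [hypersingular_smul, smul_comm a]
  · refine (integrable_smul_of_norm_le hu f.aestronglyMeasurable_hypersingular (h f)).2.trans
      (le_of_eq ?_)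
    unfold weightedNorm; ring

end SchwartzMap

end WeightedFunctional

/-! ### The principal value as an absolutely convergent integral. -/

section PrincipalValue

open Module
open scoped SchwartzMap

variable {E : Type*} [NormedAddCommGroup E] [InnerProductSpace ℝ E] [FiniteDimensional ℝ E]
  [MeasurableSpace E] [BorelSpace E] [Nontrivial E] {q : ℝ}

theorem SchwartzMap.integrableOn_compl_ball_sub_div (hq : (finrank ℝ E : ℝ) < q) (f : 𝓢(E, ℝ))
    (x : E) {ε : ℝ} (hε : 0 < ε) :
    IntegrableOn (fun z => (f x - f z) / ‖x - z‖ ^ q) (Metric.ball x ε)ᶜ := by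
  have hq0 : 0 < q := lt_of_le_of_lt (Nat.cast_nonneg _) hq
  obtain ⟨K, -, hK⟩ := integrable_norm_rpow_compl_ball (E := E) volume (s := -q) (by linarith)
  -- The radius ε/2 makes the strict inequality in the indicator hold on the sphere |x - z| = ε as
  -- well.
  have h1 := (hK (ε / 2) (by positivity)).1.comp_sub_left x
  have hb : Integrable (fun z => 2 * SchwartzMap.seminorm ℝ 0 0 f *
      (Set.Ioi (ε / 2)).indicator (fun r : ℝ => r ^ (-q)) ‖x - z‖) := h1.const_mul _
  refine hb.integrableOn.mono' (Measurable.aestronglyMeasurable ?_) ?_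
  · have := f.continuous.measurable; fun_prop
  · refine (ae_restrict_iff' Metric.isOpen_ball.measurableSet.compl).2
      (Eventually.of_forall fun z hz => ?_)
    have hz' : ε ≤ ‖x - z‖ := by
      rw [← dist_eq_norm, dist_comm]; simpa using hz
    rw [Set.indicator_of_mem (Set.mem_Ioi.2 (by linarith)), norm_div,
      Real.norm_of_nonneg (Real.rpow_nonneg (norm_nonneg _) q), Real.rpow_neg (norm_nonneg _),
      ← div_eq_mul_inv]
    gcongr
    refine (norm_sub_le _ _).trans ?_
    linarith [f.norm_le_seminorm ℝ x, f.norm_le_seminorm ℝ z]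

/-- Averaging the substitutions z = x + y and z = x - y cancels the first-order term, whence the
factor 1/2. -/
theorem SchwartzMap.setIntegral_compl_ball_sub_div (hq : (finrank ℝ E : ℝ) < q) (f : 𝓢(E, ℝ))
    (x : E) {ε : ℝ} (hε : 0 < ε) :
    ∫ z in (Metric.ball x ε)ᶜ, (f x - f z) / ‖x - z‖ ^ q =
      1 / 2 * ∫ y, (Metric.ball (0 : E) ε)ᶜ.indicator
        (fun y => (‖y‖ ^ q)⁻¹ • secondDiff f x y) y := by
  have hm : MeasurableSet (Metric.ball x ε)ᶜ := Metric.isOpen_ball.measurableSet.compl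
  set g : E → ℝ := (Metric.ball x ε)ᶜ.indicator fun z => (f x - f z) / ‖x - z‖ ^ q with hg
  have hgi : Integrable g := (integrable_indicator_iff hm).2
    (f.integrableOn_compl_ball_sub_div hq x hε)
  have e1 : ∫ y, g (x + y) = ∫ z, g z := integral_add_left_eq_self g x
  have e2 : ∫ y, g (x - y) = ∫ z, g z := integral_sub_left_eq_self g volume x
  have e3 : ∀ y, g (x + y) + g (x - y) = (Metric.ball (0 : E) ε)ᶜ.indicator
      (fun y => (‖y‖ ^ q)⁻¹ • secondDiff f x y) y := by
    intro y
    by_cases hy : y ∈ (Metric.ball (0 : E) ε)ᶜ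
    · have h1 : x + y ∈ (Metric.ball x ε)ᶜ := by simpa using hy
      have h2 : x - y ∈ (Metric.ball x ε)ᶜ := by simpa [dist_eq_norm] using hy
      rw [hg, Set.indicator_of_mem h1, Set.indicator_of_mem h2, Set.indicator_of_mem hy]
      simp only [sub_add_cancel_left, norm_neg, sub_sub_cancel, secondDiff, smul_eq_mul]
      ring
    · have h1 : x + y ∉ (Metric.ball x ε)ᶜ := by simpa using hy
      have h2 : x - y ∉ (Metric.ball x ε)ᶜ := by simpa [dist_eq_norm] using hy
      rw [hg, Set.indicator_of_notMem h1, Set.indicator_of_notMem h2, Set.indicator_of_notMem hy,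
        add_zero]
  rw [← integral_congr_ae (Eventually.of_forall e3),
    integral_add (hgi.comp_add_left x) (hgi.comp_sub_left x), e1, e2, hg, integral_indicator hm]
  ring

theorem SchwartzMap.tendsto_setIntegral_compl_ball (hq : (finrank ℝ E : ℝ) < q)
    (hq2 : q < finrank ℝ E + 2) (f : 𝓢(E, ℝ)) (x : E) :
    Tendsto (fun ε : ℝ => ∫ z in (Metric.ball x ε)ᶜ, (f x - f z) / ‖x - z‖ ^ q) (𝓝[>] 0)
      (𝓝 (1 / 2 * hypersingular q f x)) := by
  have hq0 : 0 < q := lt_of_le_of_lt (Nat.cast_nonneg _) hq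
  have hi := f.integrable_secondDiff hq hq2 x
  have key : Tendsto (fun ε : ℝ => ∫ y, (Metric.ball (0 : E) ε)ᶜ.indicator
      (fun y => (‖y‖ ^ q)⁻¹ • secondDiff f x y) y) (𝓝[>] 0) (𝓝 (hypersingular q f x)) := by
    refine tendsto_integral_filter_of_dominated_convergence _
      (Eventually.of_forall fun ε => hi.aestronglyMeasurable.indicator
        Metric.isOpen_ball.measurableSet.compl)
      (Eventually.of_forall fun ε => Eventually.of_forall fun y => norm_indicator_le_norm_self _ _)
      hi.norm (Eventually.of_forall fun y => ?_)
    rcases eq_or_ne y 0 with rfl | hy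
    · refine tendsto_const_nhds.congr fun ε => ?_
      have h0 : secondDiff f x 0 = 0 := by simp [secondDiff]
      simp [Set.indicator, h0]
    · have hy0 : 0 < ‖y‖ := norm_pos_iff.2 hy
      refine tendsto_const_nhds.congr' ?_
      filter_upwards [mem_nhdsWithin_of_mem_nhds (Iio_mem_nhds hy0)] with ε hε
      rw [Set.indicator_of_mem]
      simpa using le_of_lt hε
  refine (key.const_mul (1 / 2)).congr' ?_
  filter_upwards [self_mem_nhdsWithin] with ε hε
  rw [f.setIntegral_compl_ball_sub_div hq x hε]

end PrincipalValue

/-! ### From distributional harmonicity to Schwartz test functions. -/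

section AlphaHarmonic

open Module
open scoped SchwartzMap

theorem fracLaplacian_eq_hypersingular {n : ℕ} [NeZero n] {α : ℝ} (hα0 : 0 < α) (hα2 : α < 2)
    (f : 𝓢(EuclideanSpace ℝ (Fin n), ℝ)) (x : EuclideanSpace ℝ (Fin n)) :
    fracLaplacian α f x = fracLaplacianConst n α / 2 * hypersingular (n + α) f x := by
  have := f.tendsto_setIntegral_compl_ball (q := n + α) (by simpa using hα0)
    (by simpa using hα2) x
  rw [fracLaplacian, this.limUnder_eq]; ring

/-- Since 0 < α/2 < 1, the point -α/2 is not a pole of Γ. `Real.Gamma` takes the value 0 at poles,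
so this must be checked before dividing by the constant. -/
theorem fracLaplacianConst_ne_zero (n : ℕ) {α : ℝ} (hα0 : 0 < α) (hα2 : α < 2) :
    fracLaplacianConst n α ≠ 0 := by
  have h1 : Real.Gamma (-α / 2) ≠ 0 := by
    refine Real.Gamma_ne_zero fun m hm => ?_
    have h : (m : ℝ) = α / 2 := by linarith
    have h0 : (0 : ℝ) < m := by rw [h]; linarith
    have h2 : (m : ℝ) < 1 := by rw [h]; linarith
    norm_cast at h0 h2; omega
  have h2 : 0 < Real.Gamma ((n + α) / 2) := Real.Gamma_pos_of_pos (by positivity)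
  have h3 : 0 < |Real.Gamma (-α / 2)| := abs_pos.2 h1
  unfold fracLaplacianConst
  positivity

theorem MemLAlpha.integrable_mul_rpow {n : ℕ} {α : ℝ} (hα0 : 0 < α)
    {u : EuclideanSpace ℝ (Fin n) → ℝ} (hu : MemLAlpha α u) :
    Integrable fun x => u x * (1 + ‖x‖) ^ (-(n + α) : ℝ) := by
  set q : ℝ := n + α with hq
  have hq0 : 0 ≤ q := by positivity
  have hm : Measurable fun x : EuclideanSpace ℝ (Fin n) => (1 + ‖x‖ ^ q) * (1 + ‖x‖) ^ (-q) := by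
    fun_prop
  refine ((Integrable.bdd_mul (c := 2) hu hm.aestronglyMeasurable
    (Eventually.of_forall fun x => ?_))).congr (Eventually.of_forall fun x => ?_)
  · have h0 := norm_nonneg x
    rw [Real.norm_of_nonneg (by positivity), Real.rpow_neg (by positivity), ← div_eq_mul_inv,
      div_le_iff₀ (by positivity)]
    have h1 : 1 ≤ (1 + ‖x‖) ^ q := Real.one_le_rpow (by linarith) hq0
    have h2 : ‖x‖ ^ q ≤ (1 + ‖x‖) ^ q := Real.rpow_le_rpow h0 (by linarith) hq0
    linarith
  · have : 0 < 1 + ‖x‖ ^ q := by positivity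
    simp only [← hq]
    field_simp

/-- Real and imaginary parts reduce compactly supported f to the hypothesis; both sides are
continuous in f, and such f are dense. -/
theorem IsAlphaHarmonic.integral_smul_hypersingular_eq_zero {n : ℕ} [NeZero n] {α : ℝ}
    (hα0 : 0 < α) (hα2 : α < 2) {u : EuclideanSpace ℝ (Fin n) → ℝ} (hu : IsAlphaHarmonic α u)
    (f : 𝓢(EuclideanSpace ℝ (Fin n), ℂ)) :
    ∫ x, u x • hypersingular (n + α) f x = 0 := by
  let E := EuclideanSpace ℝ (Fin n)
  have hq : (finrank ℝ E : ℝ) < n + α := by simpa [E] using hα0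
  have hq2 : n + α < (finrank ℝ E : ℝ) + 2 := by simpa [E] using hα2
  have hw := hu.memLAlpha.integrable_mul_rpow hα0
  have hreal : ∀ g : 𝓢(E, ℝ), HasCompactSupport g →
      ∫ x, u x * hypersingular (n + α) g x = 0 := by
    intro g hg
    have := hu.integral_eq_zero g (g.smooth ⊤) hg
    simp only [fracLaplacian_eq_hypersingular hα0 hα2] at this
    have e : ∀ x, u x * (fracLaplacianConst n α / 2 * hypersingular (n + α) g x) =
        fracLaplacianConst n α / 2 * (u x * hypersingular (n + α) g x) := fun x => by ring
    simp only [e, integral_const_mul] at this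
    exact (mul_eq_zero.1 this).resolve_left
      (div_ne_zero (fracLaplacianConst_ne_zero n hα0 hα2) two_ne_zero)
  have hcomp : ∀ (L : ℂ →L[ℝ] ℝ) (f : 𝓢(E, ℂ)), HasCompactSupport f →
      L (∫ x, u x • hypersingular (n + α) f x) = 0 := by
    intro L f hf
    rw [← L.integral_comp_comm (f.integrable_smul_hypersingular hq hq2 hw),
      ← hreal (f.postcompCLM L) (hf.comp_left (g := L) (map_zero L))]
    refine integral_congr_ae (Eventually.of_forall fun x => ?_)
    simp only [map_smul, smul_eq_mul]
    congr 1
    unfold hypersingular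
    rw [← L.integral_comp_comm (f.integrable_secondDiff hq hq2 x)]
    simp only [map_smul, secondDiff, map_add, map_sub, SchwartzMap.postcompCLM_apply]
  refine congrFun (Continuous.ext_on SchwartzMap.dense_hasCompactSupport
    (SchwartzMap.continuous_integral_smul_hypersingular hq hq2 hw) (continuous_const (y := (0 : ℂ)))
    fun f hf => ?_) f
  exact Complex.ext (hcomp Complex.reCLM f hf) (hcomp Complex.imCLM f hf)

end AlphaHarmonic

/-! ### The Fourier symbol is a multiple of a power of |ξ|. -/

section Symbol

open Module FourierTransform
open scoped SchwartzMap

variable {E : Type*} [NormedAddCommGroup E] [InnerProductSpace ℝ E] [FiniteDimensional ℝ E]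
  [MeasurableSpace E] [BorelSpace E]

/-- The Fourier symbol `∫ (2 - 2 cos(2π⟨y, ξ⟩)) / |y| ^ q dy` of the hypersingular integral. -/
noncomputable def hypersingularSymbol (q : ℝ) (ξ : E) : ℝ :=
  ∫ y : E, (‖y‖ ^ q)⁻¹ * (2 - 2 * Real.cos (2 * Real.pi * inner ℝ y ξ))

theorem two_sub_two_mul_cos_nonneg (t : ℝ) : 0 ≤ 2 - 2 * Real.cos t := by
  linarith [Real.cos_le_one t]

/-- Uses 1 - cos t ≤ t²/2 for |y| ≤ 1 and 2 - 2 cos t ≤ 4 beyond. The bound is a product of a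
function of y and one of ξ, as Fubini needs. -/
theorem exists_integrable_symbol_bound [Nontrivial E] {q : ℝ} (hq : (finrank ℝ E : ℝ) < q)
    (hq2 : q < finrank ℝ E + 2) :
    ∃ h : E → ℝ, Integrable h ∧ (∀ y, 0 ≤ h y) ∧ ∀ y ξ : E,
      (‖y‖ ^ q)⁻¹ * (2 - 2 * Real.cos (2 * Real.pi * inner ℝ y ξ)) ≤ h y * (1 + ‖ξ‖ ^ 2) := by
  obtain ⟨K₁, -, h₁⟩ := integrable_norm_rpow_ball (E := E) volume (s := 2 - q) (by linarith)
  obtain ⟨K₂, -, h₂⟩ := integrable_norm_rpow_compl_ball (E := E) volume (s := -q) (by linarith)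
  have hq0 : 0 < q := lt_of_le_of_lt (Nat.cast_nonneg _) hq
  refine ⟨fun y => (2 * Real.pi) ^ 2 * (Set.Iic (1 : ℝ)).indicator (fun r : ℝ => r ^ (2 - q)) ‖y‖ +
      4 * (Set.Ioi (1 : ℝ)).indicator (fun r : ℝ => r ^ (-q)) ‖y‖,
    ((h₁ 1 one_pos).1.const_mul _).add ((h₂ 1 one_pos).1.const_mul _), fun y => ?_, fun y ξ => ?_⟩
  · have a : 0 ≤ (Set.Iic (1 : ℝ)).indicator (fun r : ℝ => r ^ (2 - q)) ‖y‖ :=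
      Set.indicator_apply_nonneg fun _ => by positivity
    have b : 0 ≤ (Set.Ioi (1 : ℝ)).indicator (fun r : ℝ => r ^ (-q)) ‖y‖ :=
      Set.indicator_apply_nonneg fun _ => by positivity
    positivity
  · rcases le_or_gt ‖y‖ 1 with hy | hy
    · simp only [Set.indicator_of_mem (Set.mem_Iic.2 hy),
        Set.indicator_of_notMem (show ‖y‖ ∉ Set.Ioi (1 : ℝ) from not_lt.2 hy), mul_zero, add_zero]
      rcases (norm_nonneg y).eq_or_lt with h0 | h0
      · rw [← h0, Real.zero_rpow hq0.ne', inv_zero, zero_mul]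
        have := Real.rpow_nonneg (le_refl (0 : ℝ)) (2 - q)
        positivity
      · have e : ‖y‖ ^ (2 - q) = (‖y‖ ^ q)⁻¹ * ‖y‖ ^ 2 := by
          rw [sub_eq_add_neg, Real.rpow_add h0, Real.rpow_neg h0.le, mul_comm]; norm_num
        have hc : 2 - 2 * Real.cos (2 * Real.pi * inner ℝ y ξ) ≤
            (2 * Real.pi) ^ 2 * ‖y‖ ^ 2 * ‖ξ‖ ^ 2 := by
          have h1 := Real.one_sub_sq_div_two_le_cos (x := 2 * Real.pi * inner ℝ y ξ)
          have h2 : (inner ℝ y ξ) ^ 2 ≤ (‖y‖ * ‖ξ‖) ^ 2 :=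
            sq_le_sq' (by linarith [abs_le.1 (abs_real_inner_le_norm y ξ)]) (real_inner_le_norm y ξ)
          have h3 := mul_le_mul_of_nonneg_left h2 (sq_nonneg (2 * Real.pi))
          nlinarith
        rw [e]
        calc _ ≤ (‖y‖ ^ q)⁻¹ * ((2 * Real.pi) ^ 2 * ‖y‖ ^ 2 * ‖ξ‖ ^ 2) := by gcongr
          _ = (2 * Real.pi) ^ 2 * ((‖y‖ ^ q)⁻¹ * ‖y‖ ^ 2) * ‖ξ‖ ^ 2 := by ring
          _ ≤ _ := by gcongr; linarith
    · simp only [Set.indicator_of_mem (Set.mem_Ioi.2 hy),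
        Set.indicator_of_notMem (show ‖y‖ ∉ Set.Iic (1 : ℝ) from not_le.2 hy), mul_zero, zero_add]
      have h0 : 0 < ‖y‖ := one_pos.trans hy
      rw [Real.rpow_neg h0.le]
      have h1 := Real.neg_one_le_cos (2 * Real.pi * inner ℝ y ξ)
      calc _ ≤ (‖y‖ ^ q)⁻¹ * 4 := by gcongr; linarith
        _ = 4 * (‖y‖ ^ q)⁻¹ * 1 := by ring
        _ ≤ _ := by gcongr; simp

theorem measurable_symbol_integrand (q : ℝ) :
    Measurable fun p : E × E =>
      (‖p.1‖ ^ q)⁻¹ * (2 - 2 * Real.cos (2 * Real.pi * inner ℝ p.1 p.2)) := by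
  have : Measurable fun p : E × E => Real.cos (2 * Real.pi * inner ℝ p.1 p.2) :=
    Continuous.measurable (by fun_prop)
  fun_prop

theorem integrable_symbol_integrand [Nontrivial E] {q : ℝ} (hq : (finrank ℝ E : ℝ) < q)
    (hq2 : q < finrank ℝ E + 2) (ξ : E) :
    Integrable fun y : E => (‖y‖ ^ q)⁻¹ * (2 - 2 * Real.cos (2 * Real.pi * inner ℝ y ξ)) := by
  obtain ⟨h, hi, h0, hle⟩ := exists_integrable_symbol_bound (E := E) hq hq2
  refine (hi.mul_const (1 + ‖ξ‖ ^ 2)).mono'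
    ((measurable_symbol_integrand q).comp (measurable_id.prodMk measurable_const)).aestronglyMeasurable
    (Eventually.of_forall fun y => ?_)
  rw [Real.norm_of_nonneg (mul_nonneg (by positivity) (two_sub_two_mul_cos_nonneg _))]
  exact hle y ξ

theorem hypersingularSymbol_smul (q : ℝ) {t : ℝ} (ht : 0 < t) (ξ : E) :
    hypersingularSymbol q (t • ξ) = t ^ (q - finrank ℝ E) * hypersingularSymbol q ξ := by
  have h := Measure.integral_comp_smul (volume : Measure E)
    (fun y : E => (‖y‖ ^ q)⁻¹ * (2 - 2 * Real.cos (2 * Real.pi * inner ℝ y ξ))) t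
  have e : ∀ y : E, (‖t • y‖ ^ q)⁻¹ * (2 - 2 * Real.cos (2 * Real.pi * inner ℝ (t • y) ξ)) =
      (t ^ q)⁻¹ * ((‖y‖ ^ q)⁻¹ * (2 - 2 * Real.cos (2 * Real.pi * inner ℝ y (t • ξ)))) := by
    intro y
    rw [norm_smul, Real.norm_of_nonneg ht.le, Real.mul_rpow ht.le (norm_nonneg _),
      real_inner_smul_left, real_inner_smul_right, mul_inv]
    ring
  simp only [e, integral_const_mul] at h
  rw [abs_of_pos (by positivity), smul_eq_mul, ← Real.rpow_natCast] at h
  unfold hypersingularSymbol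
  rw [Real.rpow_sub ht]
  have : 0 < t ^ q := Real.rpow_pos_of_pos ht _
  have : 0 < t ^ (finrank ℝ E : ℝ) := Real.rpow_pos_of_pos ht _
  field_simp at h ⊢
  linarith

theorem hypersingularSymbol_isometry (q : ℝ) (U : E ≃ₗᵢ[ℝ] E) (ξ : E) :
    hypersingularSymbol q (U ξ) = hypersingularSymbol q ξ := by
  unfold hypersingularSymbol
  rw [← U.measurePreserving.integral_comp U.toHomeomorph.measurableEmbedding]
  simp

theorem hypersingularSymbol_eq_of_norm_eq (q : ℝ) {ξ η : E} (h : ‖ξ‖ = ‖η‖) :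
    hypersingularSymbol q ξ = hypersingularSymbol q η := by
  rw [← Submodule.reflection_sub h, hypersingularSymbol_isometry]

theorem hypersingularSymbol_pos [Nontrivial E] {q : ℝ} (hq : (finrank ℝ E : ℝ) < q)
    (hq2 : q < finrank ℝ E + 2) {ξ : E} (hξ : ξ ≠ 0) : 0 < hypersingularSymbol q ξ := by
  have h0 : ∀ y : E, 0 ≤ (‖y‖ ^ q)⁻¹ * (2 - 2 * Real.cos (2 * Real.pi * inner ℝ y ξ)) := fun y =>
    mul_nonneg (by positivity) (two_sub_two_mul_cos_nonneg _)
  unfold hypersingularSymbol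
  rw [integral_pos_iff_support_of_nonneg h0 (integrable_symbol_integrand hq hq2 ξ)]
  have ho : IsOpen {y : E | y ≠ 0 ∧ Real.cos (2 * Real.pi * inner ℝ y ξ) < 1} :=
    isOpen_ne.inter (isOpen_lt (Real.continuous_cos.comp (by fun_prop)) continuous_const)
  have hn : ‖ξ‖ ≠ 0 := norm_ne_zero_iff.2 hξ
  -- This point makes the phase equal to π, where the cosine is -1.
  refine (ho.measure_pos volume ⟨(1 / (2 * ‖ξ‖ ^ 2)) • ξ, ?_, ?_⟩).trans_le
    (measure_mono fun y hy => ?_)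
  · have : (1 / (2 * ‖ξ‖ ^ 2)) ≠ 0 := by positivity
    exact smul_ne_zero this hξ
  · have : 2 * Real.pi * inner ℝ ((1 / (2 * ‖ξ‖ ^ 2)) • ξ) ξ = Real.pi := by
      rw [real_inner_smul_left, real_inner_self_eq_norm_sq]; field_simp
    rw [this, Real.cos_pi]; norm_num
  · have h1 : 0 < ‖y‖ := norm_pos_iff.2 hy.1
    have h2 : 0 < 2 - 2 * Real.cos (2 * Real.pi * inner ℝ y ξ) := by linarith [hy.2]
    exact (mul_pos (by positivity) h2).ne'

/-- The symbol is rotation invariant and homogeneous of degree q - d, so its value on the unit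
sphere determines it. -/
theorem exists_hypersingularSymbol_eq [Nontrivial E] {q : ℝ} (hq : (finrank ℝ E : ℝ) < q)
    (hq2 : q < finrank ℝ E + 2) :
    ∃ c : ℝ, 0 < c ∧ ∀ ξ : E, ξ ≠ 0 →
      hypersingularSymbol q ξ = c * ‖ξ‖ ^ (q - finrank ℝ E) := by
  obtain ⟨e, he⟩ := exists_norm_eq E zero_le_one
  have he0 : e ≠ 0 := by rintro rfl; simp at he
  refine ⟨hypersingularSymbol q e, hypersingularSymbol_pos hq hq2 he0, fun ξ hξ => ?_⟩
  rw [hypersingularSymbol_eq_of_norm_eq q (η := ‖ξ‖ • e) (by simp [norm_smul, he]),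
    hypersingularSymbol_smul q (norm_pos_iff.2 hξ), mul_comm]

theorem secondDiff_fourierInv (g : 𝓢(E, ℂ)) (x y : E) :
    secondDiff (𝓕⁻ (g : E → ℂ)) x y = ∫ ξ : E, Real.fourierChar (inner ℝ ξ x) •
      (((2 - 2 * Real.cos (2 * Real.pi * inner ℝ y ξ) : ℝ) : ℂ) * g ξ) := by
  have hi : ∀ z : E, Integrable fun ξ : E => Real.fourierChar (inner ℝ ξ z) • g ξ := fun z => by
    refine g.integrable.norm.mono' (Continuous.aestronglyMeasurable (by fun_prop))
      (Eventually.of_forall fun ξ => (Circle.norm_smul _ _).le)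
  simp only [secondDiff, Real.fourierInv_eq]
  have hs : ∀ z : E, Integrable fun ξ : E =>
      Real.fourierChar (inner ℝ ξ x) • g ξ - Real.fourierChar (inner ℝ ξ z) • g ξ := fun z =>
    (hi x).sub (hi z)
  rw [← integral_sub (hi _) (hi _), ← integral_sub (hi _) (hi _), ← integral_add (hs _) (hs _)]
  refine integral_congr_ae (Eventually.of_forall fun ξ => ?_)
  simp only [inner_add_right, inner_sub_right, Circle.smul_def, Real.fourierChar_apply,
    smul_eq_mul, real_inner_comm ξ y]
  push_cast
  rw [Complex.cos]
  simp only [mul_add, mul_sub, add_mul, sub_mul, Complex.exp_add, Complex.exp_sub]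
  rw [neg_mul, Complex.exp_neg]
  field_simp
  ring

/-- Under the inverse transform a second difference multiplies by 2 - 2cos(2π⟨y, ξ⟩); Fubini then
integrates this factor in y first. -/
theorem hypersingular_fourierInv [Nontrivial E] {q : ℝ} (hq : (finrank ℝ E : ℝ) < q)
    (hq2 : q < finrank ℝ E + 2) (g : 𝓢(E, ℂ)) (x : E) :
    hypersingular q (𝓕⁻ (g : E → ℂ)) x =
      𝓕⁻ (fun ξ : E => (hypersingularSymbol q ξ : ℂ) * g ξ) x := by
  obtain ⟨h, hi, h0, hle⟩ := exists_integrable_symbol_bound (E := E) hq hq2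
  have hg : Integrable fun ξ : E => (1 + ‖ξ‖ ^ 2) * ‖g ξ‖ := by
    have := g.integrable.norm.add (g.integrable_pow_mul volume 2)
    refine this.congr (Eventually.of_forall fun ξ => ?_)
    simp only [Pi.add_apply]; ring
  set G : E → E → ℂ := fun y ξ => (‖y‖ ^ q)⁻¹ • (Real.fourierChar (inner ℝ ξ x) •
      (((2 - 2 * Real.cos (2 * Real.pi * inner ℝ y ξ) : ℝ) : ℂ) * g ξ)) with hG
  have hGe : ∀ y ξ, G y ξ = (((‖y‖ ^ q)⁻¹ * (2 - 2 * Real.cos (2 * Real.pi * inner ℝ y ξ)) : ℝ) : ℂ)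
      * (Real.fourierChar (inner ℝ ξ x) • g ξ) := fun y ξ => by
    simp only [hG, Circle.smul_def, smul_eq_mul, Complex.real_smul]; push_cast; ring
  have hGi : Integrable (Function.uncurry G) (volume.prod volume) := by
    refine (hi.mul_prod hg).mono' ?_ (Eventually.of_forall fun p => ?_)
    · have h1 : StronglyMeasurable fun p : E × E =>
          (((‖p.1‖ ^ q)⁻¹ * (2 - 2 * Real.cos (2 * Real.pi * inner ℝ p.1 p.2)) : ℝ) : ℂ) :=
        (Complex.measurable_ofReal.comp (measurable_symbol_integrand q)).stronglyMeasurable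
      have h2 : Continuous fun p : E × E => Real.fourierChar (inner ℝ p.2 x) • g p.2 := by
        fun_prop
      refine (h1.mul h2.stronglyMeasurable).aestronglyMeasurable.congr
        (Eventually.of_forall fun p => ?_)
      exact (hGe p.1 p.2).symm
    · simp only [Function.uncurry, hGe]
      rw [norm_mul, Circle.norm_smul, Complex.norm_real, Real.norm_of_nonneg
        (mul_nonneg (by positivity) (two_sub_two_mul_cos_nonneg _)), ← mul_assoc]
      exact mul_le_mul_of_nonneg_right (hle _ _) (norm_nonneg _)
  unfold hypersingular
  simp only [secondDiff_fourierInv, ← integral_smul]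
  rw [integral_integral_swap hGi, Real.fourierInv_eq]
  refine integral_congr_ae (Eventually.of_forall fun ξ => ?_)
  simp only [hGe]
  rw [integral_mul_const, integral_complex_ofReal]
  simp only [hypersingularSymbol, Circle.smul_def, smul_eq_mul]
  ring

end Symbol

/-! ### Reduction to low frequencies. -/

section LowFrequency

open Module FourierTransform
open scoped SchwartzMap

variable {E : Type*} [NormedAddCommGroup E] [InnerProductSpace ℝ E] [FiniteDimensional ℝ E]

namespace SchwartzMap

/-- The dilated cutoff `ξ ↦ χ(c ξ)` as a complex Schwartz function. -/
noncomputable def dilatedBump (χ : ContDiffBump (0 : E)) {c : ℝ} (hc : 0 < c) : 𝓢(E, ℂ) :=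
  HasCompactSupport.toSchwartzMap (f := fun ξ : E => (χ (c • ξ) : ℂ))
    ((χ.hasCompactSupport.comp_homeomorph (Homeomorph.smulOfNeZero c hc.ne')).comp_left
      (g := Complex.ofReal) Complex.ofReal_zero)
    (Complex.ofRealCLM.contDiff.comp (χ.contDiff.comp (contDiff_const_smul c)))

@[simp]
theorem dilatedBump_apply (χ : ContDiffBump (0 : E)) {c : ℝ} (hc : 0 < c) (ξ : E) :
    dilatedBump χ hc ξ = (χ (c • ξ) : ℂ) := rfl

theorem contDiff_one_sub_bump_mul_rpow (χ : ContDiffBump (0 : E)) (c s : ℝ) :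
    ContDiff ℝ ∞ fun ξ : E => (1 - χ (c • ξ)) * ‖ξ‖ ^ s := by
  rw [contDiff_iff_contDiffAt]
  intro ξ
  rcases eq_or_ne ξ 0 with rfl | hξ
  · have : (fun ξ : E => (1 - χ (c • ξ)) * ‖ξ‖ ^ s) =ᶠ[𝓝 0] fun _ => 0 := by
      have ho : IsOpen {x : E | ‖c • x‖ < χ.rIn} := isOpen_lt (by fun_prop) (by fun_prop)
      filter_upwards [ho.mem_nhds (by simpa using χ.rIn_pos)] with z hz
      have : χ (c • z) = 1 := χ.one_of_mem_closedBall (by simpa using le_of_lt hz)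
      simp [this]
    exact contDiffAt_const.congr_of_eventuallyEq this
  · refine (contDiffAt_const.sub
      (χ.contDiff.comp (contDiff_const_smul c)).contDiffAt).mul ?_
    exact (contDiffAt_norm ℝ hξ).rpow_const_of_ne (norm_ne_zero_iff.2 hξ)

variable [MeasurableSpace E] [BorelSpace E]

theorem dense_hasCompactSupport_fourier :
    Dense ((fun g : 𝓢(E, ℂ) => (𝓕⁻ g : 𝓢(E, ℂ))) '' {g | HasCompactSupport g}) := by
  refine DenseRange.dense_image ?_ ?_ dense_hasCompactSupport
  · refine Function.Surjective.denseRange fun f => ⟨𝓕 f, ?_⟩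
    simp
  · exact (fourierInvCLM ℂ 𝓢(E, ℂ)).continuous

/-- Functions with no low frequencies are hypersingular integrals of Schwartz functions. -/
theorem exists_hypersingular_eq [Nontrivial E] {q : ℝ} (hq : (finrank ℝ E : ℝ) < q)
    (hq2 : q < finrank ℝ E + 2) (χ : ContDiffBump (0 : E)) {c : ℝ} (hc : 0 < c)
    (g : 𝓢(E, ℂ)) (hg : HasCompactSupport g) :
    ∃ f : 𝓢(E, ℂ), ∀ x, hypersingular q f x =
      (𝓕⁻ g : 𝓢(E, ℂ)) x - fourierMultiplierCLM ℂ (dilatedBump χ hc) (𝓕⁻ g) x := by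
  obtain ⟨a, ha, hA⟩ := exists_hypersingularSymbol_eq (E := E) hq hq2
  set s : ℝ := q - finrank ℝ E
  -- The inverse symbol times 1 - χ(cξ): the cutoff removes the singularity at the origin, so the
  -- product with g stays smooth.
  let m : E → ℝ := fun ξ => (1 - χ (c • ξ)) * ‖ξ‖ ^ (-s)
  have hm : ContDiff ℝ ∞ fun ξ => (((a⁻¹ * m ξ : ℝ) : ℂ) * g ξ) :=
    (Complex.ofRealCLM.contDiff.comp
      (contDiff_const.mul (contDiff_one_sub_bump_mul_rpow χ c (-s)))).mul (g.smooth ⊤)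
  let G : 𝓢(E, ℂ) := HasCompactSupport.toSchwartzMap
    (f := fun ξ => (((a⁻¹ * m ξ : ℝ) : ℂ) * g ξ)) hg.mul_left hm
  have hGA : ∀ ξ, (hypersingularSymbol q ξ : ℂ) * G ξ = g ξ - dilatedBump χ hc ξ * g ξ := by
    intro ξ
    have hG : G ξ = ((a⁻¹ * m ξ : ℝ) : ℂ) * g ξ := rfl
    rw [hG, dilatedBump_apply, ← mul_assoc, ← Complex.ofReal_mul]
    have : hypersingularSymbol q ξ * (a⁻¹ * m ξ) = 1 - χ (c • ξ) := by
      rcases eq_or_ne ξ 0 with rfl | hξ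
      · have : χ (0 : E) = 1 := χ.one_of_mem_closedBall (by simpa using χ.rIn_pos.le)
        simp [m, this]
      · have h0 : 0 < ‖ξ‖ := norm_pos_iff.2 hξ
        have h1 : 0 < ‖ξ‖ ^ s := Real.rpow_pos_of_pos h0 _
        rw [hA ξ hξ]
        simp only [m, Real.rpow_neg h0.le]
        field_simp
    rw [this]; push_cast; ring
  refine ⟨𝓕⁻ G, fun x => ?_⟩
  rw [fourierInv_coe, hypersingular_fourierInv hq hq2]
  simp only [hGA]
  have e : (fun ξ => g ξ - dilatedBump χ hc ξ * g ξ) =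
      ⇑(g - smulLeftCLM ℂ (dilatedBump χ hc) g) := by
    ext ξ
    rw [sub_apply, smulLeftCLM_apply_apply (dilatedBump χ hc).hasTemperateGrowth, smul_eq_mul]
  rw [e, ← fourierInv_coe, fourierMultiplierCLM_apply, fourier_fourierInv_eq, ← sub_apply]
  exact congrArg (fun f : 𝓢(E, ℂ) => f x) ((fourierInvCLM ℂ 𝓢(E, ℂ)).map_sub _ _)

/-- For η with compactly supported Fourier transform, the difference of η and its low-frequency part
is a hypersingular integral, annihilated by u; density gives the rest. -/
theorem integral_smul_eq_integral_smul_fourierMultiplier [Nontrivial E] {q : ℝ}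
    (hq : (finrank ℝ E : ℝ) < q) (hq2 : q < finrank ℝ E + 2) {u : E → ℝ}
    (hu : Integrable fun x => u x * (1 + ‖x‖) ^ (-q))
    (h0 : ∀ f : 𝓢(E, ℂ), ∫ x, u x • hypersingular q f x = 0)
    (χ : ContDiffBump (0 : E)) {c : ℝ} (hc : 0 < c) (η : 𝓢(E, ℂ)) :
    ∫ x, u x • η x = ∫ x, u x • fourierMultiplierCLM ℂ (dilatedBump χ hc) η x := by
  refine congrFun (Continuous.ext_on dense_hasCompactSupport_fourier
    (continuous_integral_smul (F := ℂ) hq2.le hu)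
    ((continuous_integral_smul (F := ℂ) hq2.le hu).comp
      (fourierMultiplierCLM ℂ (dilatedBump χ hc)).continuous) ?_) η
  rintro _ ⟨g, hg, rfl⟩
  obtain ⟨f, hf⟩ := exists_hypersingular_eq hq hq2 χ hc g hg
  have := h0 f
  simp only [hf, smul_sub] at this
  rw [integral_sub (integrable_smul hq2.le hu _) (integrable_smul hq2.le hu _)] at this
  exact sub_eq_zero.1 this

theorem fourierMultiplier_dilatedBump_apply (χ : ContDiffBump (0 : E)) {c : ℝ} (hc : 0 < c)
    (η : 𝓢(E, ℂ)) (x : E) :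
    fourierMultiplierCLM ℂ (dilatedBump χ hc) η x =
      ∫ t, η t * (𝓕⁻ (dilatedBump χ hc) : 𝓢(E, ℂ)) (x - t) := by
  have := convolution_apply (ContinuousLinearMap.mul ℂ ℂ) η (𝓕⁻ (dilatedBump χ hc)) x
  rw [MeasureTheory.convolution_def] at this
  simp only [ContinuousLinearMap.mul_apply'] at this
  rw [← this, fourierMultiplierCLM_apply]
  change _ = (𝓕⁻ (pairing (ContinuousLinearMap.mul ℂ ℂ) (𝓕 η) (𝓕 (𝓕⁻ (dilatedBump χ hc)))) :
    𝓢(E, ℂ)) x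
  congr 2
  ext ξ
  rw [fourier_fourierInv_eq, smulLeftCLM_apply_apply (dilatedBump χ hc).hasTemperateGrowth,
    pairing_apply_apply, ContinuousLinearMap.mul_apply', smul_eq_mul, mul_comm]

theorem fourierInv_dilatedBump (χ : ContDiffBump (0 : E)) {c : ℝ} (hc : 0 < c) (x : E) :
    (𝓕⁻ (dilatedBump χ hc) : 𝓢(E, ℂ)) x =
      (c ^ finrank ℝ E)⁻¹ • (𝓕⁻ (dilatedBump χ one_pos) : 𝓢(E, ℂ)) (c⁻¹ • x) := by
  rw [fourierInv_coe, fourierInv_coe, Real.fourierInv_eq, Real.fourierInv_eq]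
  have h := Measure.integral_comp_smul (volume : Measure E) (fun ξ : E =>
    Real.fourierChar (inner ℝ ξ (c⁻¹ • x)) • dilatedBump χ one_pos ξ) c
  rw [abs_of_pos (by positivity)] at h
  rw [← h]
  refine integral_congr_ae (Eventually.of_forall fun ξ => ?_)
  simp only [dilatedBump_apply, one_smul, real_inner_smul_left, real_inner_smul_right]
  rw [inv_mul_cancel_left₀ hc.ne']

end SchwartzMap

end LowFrequency

/-! ### Weak second differences of u vanish. -/

section SecondDifferenceVanishes

open Module FourierTransform
open scoped SchwartzMap

variable {E : Type*} [NormedAddCommGroup E] [InnerProductSpace ℝ E]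

namespace SchwartzMap

/-- The symmetric second difference with fixed step, as a Schwartz function. -/
noncomputable def secondDiffMap (η : 𝓢(E, ℂ)) (h : E) : 𝓢(E, ℂ) :=
  (η - η.compSubConstCLM ℂ (-h)) + (η - η.compSubConstCLM ℂ h)

@[simp]
theorem secondDiffMap_apply (η : 𝓢(E, ℂ)) (h x : E) :
    η.secondDiffMap h x = secondDiff η x h := by
  simp [secondDiffMap, secondDiff]

variable [FiniteDimensional ℝ E] [MeasurableSpace E] [BorelSpace E]

theorem integrable_mul_comp_sub_left (η ψ : 𝓢(E, ℂ)) (x : E) :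
    Integrable fun t => η t * ψ (x - t) :=
  η.integrable.mul_bdd (c := SchwartzMap.seminorm ℝ 0 0 ψ)
    (Continuous.aestronglyMeasurable (by fun_prop))
    (Eventually.of_forall fun t => ψ.norm_le_seminorm ℝ (x - t))

theorem fourierMultiplier_secondDiffMap_apply (χ : ContDiffBump (0 : E)) {c : ℝ} (hc : 0 < c)
    (η : 𝓢(E, ℂ)) (h x : E) :
    fourierMultiplierCLM ℂ (dilatedBump χ hc) (η.secondDiffMap h) x =
      ∫ t, η t * secondDiff (𝓕⁻ (dilatedBump χ hc) : 𝓢(E, ℂ)) (x - t) h := by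
  set ψ : 𝓢(E, ℂ) := 𝓕⁻ (dilatedBump χ hc) with hψ
  have htr : ∀ a : E, fourierMultiplierCLM ℂ (dilatedBump χ hc) (η.compSubConstCLM ℂ a) x =
      ∫ t, η t * ψ (x - t - a) := by
    intro a
    rw [fourierMultiplier_dilatedBump_apply, ← hψ,
      ← integral_sub_right_eq_self (fun t => η t * ψ (x - t - a)) a]
    refine integral_congr_ae (Eventually.of_forall fun t => ?_)
    simp only [compSubConstCLM_apply]
    congr 2; abel
  have hi : ∀ a : E, Integrable fun t => η t * ψ (x - t - a) := fun a => by
    refine (integrable_mul_comp_sub_left η ψ (x - a)).congr (Eventually.of_forall fun t => ?_)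
    simp only; congr 2; abel
  have hi0 := integrable_mul_comp_sub_left η ψ x
  have hs : ∀ a : E, Integrable fun t => η t * ψ (x - t) - η t * ψ (x - t - a) := fun a =>
    hi0.sub (hi a)
  simp only [secondDiffMap, map_add, map_sub, add_apply, sub_apply, htr]
  rw [fourierMultiplier_dilatedBump_apply, ← hψ, ← integral_sub hi0 (hi _),
    ← integral_sub hi0 (hi _), ← integral_add (hs _) (hs _)]
  refine integral_congr_ae (Eventually.of_forall fun t => ?_)
  simp only [secondDiff, sub_neg_eq_add]
  ring

/-- The multiplier convolves with c^(-d) ψ(·/c). The normalization gives c^(-d), the second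
difference of ψ with step h/c gives c^(-2), and comparing the weight of (x - t)/c with that of x
costs c^q (1+|t|)^q, which the decay of η absorbs. -/
theorem exists_norm_fourierMultiplier_secondDiffMap_le {q : ℝ} (hq0 : 0 ≤ q)
    (hq2 : q ≤ finrank ℝ E + 2) (χ : ContDiffBump (0 : E)) (η : 𝓢(E, ℂ)) (h : E) :
    ∃ K : ℝ, ∀ (c : ℝ) (hc : 0 < c), 1 ≤ c → 2 * ‖h‖ ≤ c → ∀ x,
      ‖fourierMultiplierCLM ℂ (dilatedBump χ hc) (η.secondDiffMap h) x‖ ≤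
        K * c ^ (q - finrank ℝ E - 2) * (1 + ‖x‖) ^ (-q) := by
  set d := finrank ℝ E with hd
  set ψ : 𝓢(E, ℂ) := 𝓕⁻ (dilatedBump χ one_pos) with hψ
  set A : ℝ := 2 ^ (d + 2) * ψ.weightedNorm with hA
  have hA0 : 0 ≤ A := mul_nonneg (by positivity)
    (le_trans (by positivity) (ψ.one_add_pow_mul_norm_le 0))
  have hψ2 : ∀ z k : E, ‖k‖ ≤ 1 / 2 → ‖secondDiff ψ z k‖ ≤ A * ‖k‖ ^ 2 * (1 + ‖z‖) ^ (-q) := by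
    intro z k hk
    have h1 := norm_secondDiff_le_of_decay (ψ.smooth 2) ψ.one_add_pow_mul_norm_fderiv_fderiv_le
      (x := z) (y := k) (by linarith [norm_nonneg z])
    refine h1.trans ?_
    have h2 : ((1 + ‖z‖) ^ (d + 2))⁻¹ ≤ (1 + ‖z‖) ^ (-q) := by
      rw [← Real.rpow_natCast, ← Real.rpow_neg (by positivity)]
      refine Real.rpow_le_rpow_of_exponent_le (by simp) ?_
      push_cast; linarith
    calc _ = A * ‖k‖ ^ 2 * ((1 + ‖z‖) ^ (d + 2))⁻¹ := by rw [hA]; ring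
      _ ≤ _ := by gcongr
  have hηi : Integrable fun t => ‖η t‖ * (1 + ‖t‖) ^ q := by
    have h1 := ((η.integrable.norm).add (η.integrable_pow_mul volume (d + 2))).const_mul
      (2 ^ (d + 1))
    have hm : Measurable fun t : E => (1 + ‖t‖) ^ q := by fun_prop
    refine h1.mono' (η.continuous.norm.aestronglyMeasurable.mul hm.aestronglyMeasurable)
      (Eventually.of_forall fun t => ?_)
    rw [Real.norm_of_nonneg (by positivity)]
    have h2 : (1 + ‖t‖) ^ q ≤ 2 ^ (d + 1) * (1 + ‖t‖ ^ (d + 2)) := by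
      refine (Real.rpow_le_rpow_of_exponent_le (by simp) hq2).trans ?_
      have := add_pow_le zero_le_one (norm_nonneg t) (d + 2)
      rw [one_pow] at this
      exact_mod_cast this
    calc _ ≤ ‖η t‖ * (2 ^ (d + 1) * (1 + ‖t‖ ^ (d + 2))) := by gcongr
      _ = _ := by simp only [Pi.add_apply]; ring
  refine ⟨A * ‖h‖ ^ 2 * ∫ t, ‖η t‖ * (1 + ‖t‖) ^ q, fun c hc hc1 hch x => ?_⟩
  rw [fourierMultiplier_secondDiffMap_apply]
  have hpt : ∀ t, ‖η t * secondDiff (𝓕⁻ (dilatedBump χ hc) : 𝓢(E, ℂ)) (x - t) h‖ ≤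
      A * ‖h‖ ^ 2 * c ^ (q - d - 2) * (1 + ‖x‖) ^ (-q) * (‖η t‖ * (1 + ‖t‖) ^ q) := by
    intro t
    have e : secondDiff (𝓕⁻ (dilatedBump χ hc) : 𝓢(E, ℂ)) (x - t) h =
        (c ^ d)⁻¹ • secondDiff ψ (c⁻¹ • (x - t)) (c⁻¹ • h) := by
      simp only [secondDiff, fourierInv_dilatedBump χ hc, ← hψ, ← hd, smul_add, smul_sub]
    have hk : ‖c⁻¹ • h‖ ≤ 1 / 2 := by
      rw [norm_smul, Real.norm_of_nonneg (by positivity), inv_mul_le_iff₀ hc]; linarith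
    have h1 := hψ2 (c⁻¹ • (x - t)) (c⁻¹ • h) hk
    rw [norm_smul, norm_smul, Real.norm_of_nonneg (inv_nonneg.2 hc.le)] at h1
    have h2 : (1 + c⁻¹ * ‖x - t‖) ^ (-q) ≤ c ^ q * ((1 + ‖t‖) ^ q * (1 + ‖x‖) ^ (-q)) := by
      -- A rescaled Peetre inequality, using c ≥ 1.
      have h3 : (1 + ‖x‖) / (c * (1 + ‖t‖)) ≤ 1 + c⁻¹ * ‖x - t‖ := by
        rw [div_le_iff₀ (by positivity)]
        have h4 : ‖x‖ ≤ ‖x - t‖ + ‖t‖ := by simpa using norm_add_le (x - t) t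
        have h5 : (1 + c⁻¹ * ‖x - t‖) * (c * (1 + ‖t‖)) = (c + ‖x - t‖) * (1 + ‖t‖) := by
          field_simp
        rw [h5]
        nlinarith [norm_nonneg t, norm_nonneg (x - t), mul_nonneg (norm_nonneg t) (norm_nonneg (x - t)),
          mul_nonneg (sub_nonneg.2 hc1) (norm_nonneg t)]
      have h6 := Real.rpow_le_rpow_of_nonpos (z := -q) (by positivity) h3 (by linarith)
      refine h6.trans (le_of_eq ?_)
      rw [Real.div_rpow (by positivity) (by positivity), Real.mul_rpow hc.le (by positivity),
        Real.rpow_neg hc.le, Real.rpow_neg (by positivity : 0 ≤ 1 + ‖t‖)]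
      field_simp
    have h7 : c ^ (q - d - 2) = (c ^ d)⁻¹ * c⁻¹ ^ 2 * c ^ q := by
      rw [Real.rpow_sub hc, Real.rpow_sub hc, Real.rpow_natCast, Real.rpow_two]
      field_simp
    rw [norm_mul, e, norm_smul, Real.norm_of_nonneg (by positivity), h7]
    calc _ ≤ ‖η t‖ * ((c ^ d)⁻¹ * (A * (c⁻¹ * ‖h‖) ^ 2 *
          (c ^ q * ((1 + ‖t‖) ^ q * (1 + ‖x‖) ^ (-q))))) := by
          gcongr
          exact h1.trans (by gcongr)
      _ = _ := by ring
  refine (norm_integral_le_of_norm_le (hηi.const_mul _) (Eventually.of_forall hpt)).trans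
    (le_of_eq ?_)
  rw [integral_const_mul]; ring

/-- The left side does not depend on c, while the low-frequency bound carries c^(q-d-2), of negative
exponent. -/
theorem integral_smul_secondDiff_eq_zero [Nontrivial E] {q : ℝ}
    (hq : (finrank ℝ E : ℝ) < q) (hq2 : q < finrank ℝ E + 2) {u : E → ℝ}
    (hu : Integrable fun x => u x * (1 + ‖x‖) ^ (-q))
    (h0 : ∀ f : 𝓢(E, ℂ), ∫ x, u x • hypersingular q f x = 0) (η : 𝓢(E, ℂ)) (h : E) :
    ∫ x, u x • secondDiff η x h = 0 := by
  let χ : ContDiffBump (0 : E) := ⟨1, 2, by norm_num, by norm_num⟩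
  obtain ⟨K, hK⟩ := exists_norm_fourierMultiplier_secondDiffMap_le
    ((Nat.cast_nonneg _).trans hq.le) hq2.le χ η h
  have hle : ∀ᶠ c : ℝ in atTop, ‖∫ x, u x • secondDiff η x h‖ ≤
      K * c ^ (-(finrank ℝ E + 2 - q)) * ∫ x, |u x * (1 + ‖x‖) ^ (-q)| := by
    filter_upwards [eventually_ge_atTop 1, eventually_ge_atTop (2 * ‖h‖)] with c hc1 hch
    have hc : 0 < c := by linarith
    have e := integral_smul_eq_integral_smul_fourierMultiplier hq hq2 hu h0 χ hc
      (η.secondDiffMap h)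
    simp only [secondDiffMap_apply] at e
    rw [e, show -((finrank ℝ E : ℝ) + 2 - q) = q - finrank ℝ E - 2 by ring]
    exact (integrable_smul_of_norm_le hu (SchwartzMap.continuous _).aestronglyMeasurable
      (hK c hc hc1 hch)).2
  have hlim := ((tendsto_rpow_neg_atTop (y := finrank ℝ E + 2 - q) (by linarith)).const_mul
    K).mul_const (∫ x, |u x * (1 + ‖x‖) ^ (-q)|)
  rw [mul_zero, zero_mul] at hlim
  exact norm_le_zero_iff.1 (ge_of_tendsto hlim hle)

end SchwartzMap

end SecondDifferenceVanishes

/-! ### Sublinear lower growth forces translation invariance. -/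

section TranslationInvariance

open Module
open scoped SchwartzMap

variable {E : Type*} [NormedAddCommGroup E] [InnerProductSpace ℝ E] [FiniteDimensional ℝ E]
  [MeasurableSpace E] [BorelSpace E]

theorem SchwartzMap.integral_mul_secondDiff_eq_zero {u : E → ℝ}
    (h0 : ∀ (η : 𝓢(E, ℂ)) (h : E), ∫ x, u x • secondDiff η x h = 0) (η : 𝓢(E, ℝ)) (h : E) :
    ∫ x, u x * secondDiff η x h = 0 := by
  have := h0 (η.postcompCLM Complex.ofRealCLM) h
  rw [← Complex.ofReal_eq_zero, ← integral_complex_ofReal, ← this]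
  refine integral_congr_ae (Eventually.of_forall fun x => ?_)
  simp only [secondDiff, SchwartzMap.postcompCLM_apply, Complex.ofRealCLM_apply,
    Complex.real_smul]
  push_cast
  ring

theorem integral_mul_comp_sub_nsmul {q : ℝ} (hq2 : q ≤ finrank ℝ E + 2) {u : E → ℝ}
    (hu : Integrable fun x => u x * (1 + ‖x‖) ^ (-q))
    (h0 : ∀ (η : 𝓢(E, ℝ)) (h : E), ∫ x, u x * secondDiff η x h = 0) (η : 𝓢(E, ℝ)) (h : E)
    (n : ℕ) :
    ∫ x, u x * η (x - n • h) =
      (∫ x, u x * η x) + n * ((∫ x, u x * η (x - h)) - ∫ x, u x * η x) := by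
  set F : E → ℝ := fun a => ∫ x, u x * η (x - a) with hF
  have hi : ∀ a, Integrable fun x => u x * η (x - a) := fun a =>
    SchwartzMap.integrable_smul hq2 hu (η.compSubConstCLM ℝ a)
  have hs : ∀ a b, Integrable fun x => u x * η (x - a) - u x * η (x - b) := fun a b =>
    (hi a).sub (hi b)
  have step : ∀ a, F (a + h) = 2 * F a - F (a - h) := by
    intro a
    have h1 := h0 (η.compSubConstCLM ℝ a) h
    have e : ∀ x, u x * secondDiff (η.compSubConstCLM ℝ a) x h =
        (u x * η (x - a) - u x * η (x - (a - h))) + (u x * η (x - a) - u x * η (x - (a + h))) := by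
      intro x
      have e1 : x + h - a = x - (a - h) := by abel
      have e2 : x - h - a = x - (a + h) := by abel
      simp only [secondDiff, SchwartzMap.compSubConstCLM_apply, e1, e2]
      ring
    rw [integral_congr_ae (Eventually.of_forall e), integral_add (hs _ _) (hs _ _),
      integral_sub (hi _) (hi _), integral_sub (hi _) (hi _)] at h1
    simp only [hF]; linarith
  -- The recurrence has order two, so the induction carries two consecutive values.
  have main : ∀ n : ℕ, F (n • h) = F 0 + n * (F h - F 0) ∧
      F ((n + 1) • h) = F 0 + (n + 1 : ℕ) * (F h - F 0) := by
    intro n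
    induction n with
    | zero => simp
    | succ k ih =>
      refine ⟨ih.2, ?_⟩
      rw [succ_nsmul h (k + 1), step, ih.2, succ_nsmul, add_sub_cancel_right, ih.1]
      push_cast; ring
  have := (main n).1
  simpa [hF] using this

/-- If all second differences of `u` vanish weakly and the negative part of `u` has sublinear
growth, then nonnegative averages of `u` are nondecreasing under translation. -/
theorem integral_mul_le_integral_mul_comp_sub {q : ℝ} (hq2 : q ≤ finrank ℝ E + 2) {u : E → ℝ}
    (hu : Integrable fun x => u x * (1 + ‖x‖) ^ (-q))
    (h0 : ∀ (η : 𝓢(E, ℝ)) (h : E), ∫ x, u x * secondDiff η x h = 0)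
    (hlow : ∀ ε > 0, ∃ M : ℝ, ∀ᵐ x, M ≤ ‖x‖ → -ε * ‖x‖ ≤ u x)
    (η : 𝓢(E, ℝ)) (hη : ∀ x, 0 ≤ η x) {r : ℝ} (hr : ∀ x, η x ≠ 0 → ‖x‖ ≤ r) (h : E) :
    ∫ x, u x * η x ≤ ∫ x, u x * η (x - h) := by
  by_contra! hlt
  set δ := (∫ x, u x * η x) - ∫ x, u x * η (x - h) with hδ
  have hδ0 : 0 < δ := sub_pos.2 hlt
  have hh : h ≠ 0 := by rintro rfl; simp at hlt
  have hh0 : 0 < ‖h‖ := norm_pos_iff.2 hh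
  set I := ∫ x, η x with hI
  have hI0 : 0 ≤ I := integral_nonneg hη
  -- Chosen so that ε‖h‖I ≤ δ/2; the 1 keeps the denominator positive when I = 0. The averages
  -- decrease with slope -δ, but the lower bound on u only permits -δ/2.
  set ε := δ / (2 * (‖h‖ * (I + 1))) with hε
  have hε0 : 0 < ε := by positivity
  obtain ⟨M, hM⟩ := hlow ε hε0
  have hεI : ε * ‖h‖ * I ≤ δ / 2 := by
    have e : ε * ‖h‖ * (I + 1) = δ / 2 := by rw [hε]; field_simp
    rw [← e]; gcongr; linarith
  have hlower : ∀ᶠ n : ℕ in atTop, -ε * (n * ‖h‖ + r) * I ≤ ∫ x, u x * η (x - n • h) := by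
    have hlim : Tendsto (fun n : ℕ => (n : ℝ) * ‖h‖) atTop atTop :=
      tendsto_natCast_atTop_atTop.atTop_mul_const hh0
    -- Now the support of the translate lies outside the ball of radius M.
    filter_upwards [hlim.eventually_ge_atTop (M + r)] with n hn
    have hi := SchwartzMap.integrable_smul hq2 hu (η.compSubConstCLM ℝ (n • h))
    have e : I = ∫ x, η (x - n • h) := (integral_sub_right_eq_self (fun x => η x) (n • h)).symm
    rw [e, ← integral_const_mul]
    refine integral_mono_ae (((η.compSubConstCLM ℝ (n • h)).integrable).const_mul _) hi ?_
    filter_upwards [hM] with x hx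
    by_cases hx0 : η (x - n • h) = 0
    · simp [hx0]
    · have h1 := hr _ hx0
      have hnn : ‖n • h‖ = n * ‖h‖ := by rw [← Nat.cast_smul_eq_nsmul ℝ, norm_smul]; simp
      have h2 : (n : ℝ) * ‖h‖ - r ≤ ‖x‖ := by
        have := norm_sub_norm_le (n • h) x
        rw [norm_sub_rev, hnn] at this; linarith
      have h3 : ‖x‖ ≤ n * ‖h‖ + r := by
        have := norm_add_le (x - n • h) (n • h)
        rw [sub_add_cancel, hnn] at this; linarith
      have h4 := hx (by linarith)
      refine mul_le_mul_of_nonneg_right (le_trans ?_ h4) (hη _)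
      nlinarith
  have hbig : ∀ᶠ n : ℕ in atTop, (∫ x, u x * η x) + ε * r * I < n * (δ / 2) :=
    (tendsto_natCast_atTop_atTop.atTop_mul_const (half_pos hδ0)).eventually_gt_atTop _
  obtain ⟨n, hn1, hn2⟩ := (hlower.and hbig).exists
  rw [integral_mul_comp_sub_nsmul hq2 hu h0] at hn1
  have h5 : (∫ x, u x * η (x - h)) - ∫ x, u x * η x = -δ := by rw [hδ]; ring
  rw [h5] at hn1
  have h6 : (n : ℝ) * (ε * ‖h‖ * I) ≤ n * (δ / 2) := by gcongr
  nlinarith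

/-- The reverse inequality comes from translating the already translated η by -h. -/
theorem integral_mul_comp_sub_eq {q : ℝ} (hq2 : q ≤ finrank ℝ E + 2) {u : E → ℝ}
    (hu : Integrable fun x => u x * (1 + ‖x‖) ^ (-q))
    (h0 : ∀ (η : 𝓢(E, ℝ)) (h : E), ∫ x, u x * secondDiff η x h = 0)
    (hlow : ∀ ε > 0, ∃ M : ℝ, ∀ᵐ x, M ≤ ‖x‖ → -ε * ‖x‖ ≤ u x)
    (η : 𝓢(E, ℝ)) (hη : ∀ x, 0 ≤ η x) {r : ℝ} (hr : ∀ x, η x ≠ 0 → ‖x‖ ≤ r) (h : E) :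
    ∫ x, u x * η (x - h) = ∫ x, u x * η x := by
  refine le_antisymm ?_ (integral_mul_le_integral_mul_comp_sub hq2 hu h0 hlow η hη hr h)
  have := integral_mul_le_integral_mul_comp_sub hq2 hu h0 hlow (η.compSubConstCLM ℝ h)
    (fun x => hη _) (r := r + ‖h‖) (fun x hx => ?_) (-h)
  · simpa using this
  · have h1 := hr (x - h) hx
    have h2 := norm_add_le (x - h) h
    rw [sub_add_cancel] at h2; linarith

theorem locallyIntegrable_of_integrable_mul_rpow {q : ℝ} {u : E → ℝ}
    (hu : Integrable fun x => u x * (1 + ‖x‖) ^ (-q)) : LocallyIntegrable u := by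
  rw [locallyIntegrable_iff]
  intro K hK
  have hc : ContinuousOn (fun x : E => (1 + ‖x‖) ^ q) K := by
    refine Continuous.continuousOn (Continuous.rpow_const (by fun_prop) fun x => Or.inl ?_)
    positivity
  refine (hu.integrableOn.mul_continuousOn hc hK).congr (Eventually.of_forall fun x => ?_)
  simp only
  rw [mul_assoc, ← Real.rpow_add (by positivity)]; simp

/-- A locally integrable function whose averages against every smooth bump are translation
invariant is constant almost everywhere. -/
theorem exists_ae_eq_const_of_integral_normed_bump {u : E → ℝ} (hu : LocallyIntegrable u)
    (h : ∀ (φ : ContDiffBump (0 : E)) (a : E),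
      ∫ x, u x * φ.normed volume (x - a) = ∫ x, u x * φ.normed volume x) :
    ∃ C : ℝ, ∀ᵐ x, u x = C := by
  let φ : ℕ → ContDiffBump (0 : E) := fun k =>
    ⟨1 / ((k : ℝ) + 1), 2 * (1 / ((k : ℝ) + 1)), by positivity, by
      have : 0 < 1 / ((k : ℝ) + 1) := by positivity
      linarith⟩
  have hlim : Tendsto (fun k => (φ k).rOut) atTop (𝓝 0) := by
    simpa [φ] using (tendsto_one_div_add_atTop_nhds_zero_nat (𝕜 := ℝ)).const_mul 2
  have hconv := ContDiffBump.ae_convolution_tendsto_right_of_locallyIntegrable (K := 2) hlim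
    (Eventually.of_forall fun k => le_rfl) hu
  -- Translation invariance makes each mollification of u constant in x, so its limits at any two
  -- good points agree.
  have e : ∀ k x, (MeasureTheory.convolution ((φ k).normed volume) u
      (ContinuousLinearMap.lsmul ℝ ℝ) volume) x = ∫ y, u y * (φ k).normed volume y := by
    intro k x
    rw [← h (φ k) x, MeasureTheory.convolution_def,
      ← integral_sub_left_eq_self (fun y => u y * (φ k).normed volume (y - x)) volume x]
    refine integral_congr_ae (Eventually.of_forall fun t => ?_)
    simp only [ContinuousLinearMap.lsmul_apply, smul_eq_mul]
    rw [show x - t - x = -t by abel, ContDiffBump.normed_neg, mul_comm]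
  simp only [e] at hconv
  obtain ⟨x₀, hx₀⟩ := hconv.exists
  exact ⟨u x₀, hconv.mono fun x hx => tendsto_nhds_unique hx hx₀⟩

end TranslationInvariance

/-! ### The Liouville theorem. -/

section Liouville

open Module
open scoped SchwartzMap

theorem exists_neg_mul_norm_le_of_liminf {E : Type*} [NormedAddCommGroup E] [MeasureSpace E]
    {u : E → ℝ} {γ : ℝ} (hγ1 : γ ≤ 1)
    (hliminf : (0 : EReal) ≤ liminf (fun x : E => ((u x / ‖x‖ ^ γ : ℝ) : EReal))
      (Bornology.cobounded E ⊓ ae volume)) {ε : ℝ} (hε : 0 < ε) :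
    ∃ M : ℝ, ∀ᵐ x : E, M ≤ ‖x‖ → -ε * ‖x‖ ≤ u x := by
  have hlt : ((-ε : ℝ) : EReal) < liminf (fun x : E => ((u x / ‖x‖ ^ γ : ℝ) : EReal))
      (Bornology.cobounded E ⊓ ae volume) :=
    lt_of_lt_of_le (by exact_mod_cast neg_lt_zero.2 hε) hliminf
  obtain ⟨s, hs, t, ht, hst⟩ := Filter.mem_inf_iff_superset.1 (eventually_lt_of_lt_liminf hlt)
  obtain ⟨R, -, hR⟩ := (Metric.hasBasis_cobounded_compl_closedBall (0 : E)).mem_iff.1 hs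
  refine ⟨max 1 (R + 1), ?_⟩
  filter_upwards [ht] with x hxt hx
  have h1 : 1 ≤ ‖x‖ := (le_max_left _ _).trans hx
  have h2 : R < ‖x‖ := by linarith [(le_max_right 1 (R + 1)).trans hx]
  have h3 : ((-ε : ℝ) : EReal) < ((u x / ‖x‖ ^ γ : ℝ) : EReal) :=
    hst ⟨hR (by simpa using h2), hxt⟩
  have h4 : -ε < u x / ‖x‖ ^ γ := by exact_mod_cast h3
  have h5 : 0 < ‖x‖ ^ γ := Real.rpow_pos_of_pos (by linarith) _
  have h6 : ‖x‖ ^ γ ≤ ‖x‖ := by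
    simpa using Real.rpow_le_rpow_of_exponent_le h1 hγ1
  rw [lt_div_iff₀ h5] at h4
  nlinarith

theorem theorem1 (n : ℕ) (α : ℝ) (hα0 : 0 < α) (hα2 : α < 2)
    (u : EuclideanSpace ℝ (Fin n) → ℝ) (hu : IsAlphaHarmonic α u)
    (γ : ℝ) (hγ0 : 0 ≤ γ) (hγ1 : γ ≤ 1) (hγα : γ < α)
    (hliminf : (0 : EReal) ≤ liminf (fun x : EuclideanSpace ℝ (Fin n) =>
      ((u x / ‖x‖ ^ γ : ℝ) : EReal))
      (Bornology.cobounded (EuclideanSpace ℝ (Fin n)) ⊓ ae volume)) :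
    ∃ C : ℝ, (∀ᵐ x : EuclideanSpace ℝ (Fin n) ∂volume, u x = C) ∧
      (Continuous u → ∀ x : EuclideanSpace ℝ (Fin n), u x = C) := by
  -- In dimension 0 the space is a point; the polar-coordinate arguments need a nontrivial space.
  rcases Nat.eq_zero_or_pos n with rfl | hn
  · exact ⟨u 0, Eventually.of_forall fun x => by rw [Subsingleton.elim x 0],
      fun _ x => by rw [Subsingleton.elim x 0]⟩
  have : NeZero n := ⟨hn.ne'⟩
  have hq : (finrank ℝ (EuclideanSpace ℝ (Fin n)) : ℝ) < n + α := by simpa using hα0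
  have hq2 : n + α < (finrank ℝ (EuclideanSpace ℝ (Fin n)) : ℝ) + 2 := by simpa using hα2
  have hw := hu.memLAlpha.integrable_mul_rpow hα0
  have hsecond := SchwartzMap.integral_mul_secondDiff_eq_zero
    (SchwartzMap.integral_smul_secondDiff_eq_zero hq hq2 hw
      (hu.integral_smul_hypersingular_eq_zero hα0 hα2))
  obtain ⟨C, hC⟩ := exists_ae_eq_const_of_integral_normed_bump
    (locallyIntegrable_of_integrable_mul_rpow hw) fun φ a =>
      integral_mul_comp_sub_eq hq2.le hw hsecond
        (fun ε hε => exists_neg_mul_norm_le_of_liminf hγ1 hliminf hε)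
        (φ.hasCompactSupport_normed.toSchwartzMap (φ.contDiff_normed (μ := volume)))
        (fun x => φ.nonneg_normed x) (r := φ.rOut)
        (fun x hx => by
          have : x ∈ Function.support (φ.normed volume) := hx
          rw [φ.support_normed_eq] at this
          exact le_of_lt (by simpa using this)) a
  exact ⟨C, hC, fun hcont x => congrFun ((hcont.ae_eq_iff_eq volume continuous_const).1 hC) x⟩

end Liouville
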